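/- All Hilbert spaces are finite-dimensional and logarithms are to base $2$. For positive semidefinite $\rho,\sigma$ let $F(\rho,\sigma)=\operatorname{Tr}\sqrt{\sqrt\rho\,\sigma\sqrt\rho}$, let $\Pi_\rho$ be the projector onto the support of $\rho$, and let $S_0(\rho\|\sigma)=-\log\operatorname{Tr}[\Pi_\rho\sigma]$ (equal to $+\infty$ if the trace is $0$). For a state $\rho^{AB}$ on $\mathscr H_A\otimes\mathscr H_B$ and $\delta\ge 0$, the smoothed zero-coherent information is $$I_{0,\delta}^{A\to B}(\rho^{AB})=\max_{\bar\rho\in\mathfrak b(\rho^{AB};\delta)}\ \min_{\sigma^B}\ S_0(\bar\rho\,\|\,\mathbb 1_A\otimes\sigma^B),\qquad \mathfrak b(\rho;\delta)=\{\bar\rho\ge 0:\ \operatorname{Tr}\bar\rho\le 1,\ F(\rho,\bar\rho)^2\ge 1-\delta^2\},$$ where $\sigma^B$ ranges over the states on $\mathscr H_B$. A one-way LOCC map is a map $\Lambda=\sum_x\mathcal E_x\otimes\mathcal D_x$ (finite sum), where the $\mathcal E_x:A\to A'$ are completely positive with trace-preserving sum and each $\mathcal D_x:B\to B'$ is completely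 positive and trace-preserving. A maximally entangled state of rank $M\ge1$ on $A'B'$, with $\dim\mathscr H_{A'}=\dim\mathscr H_{B'}\ge M$, is (the projector onto) $M^{-1/2}\sum_{i=1}^M|e_i\rangle\otimes|f_i\rangle$ for orthonormal bases $(e_i)$, $(f_i)$. A real number $R\ge 0$ is an $\varepsilon$-achievable rate for $\rho^{AB}$ if there are an integer $M\ge 2^R$, a maximally entangled state $\Psi_M^{A'B'}$ of rank $M$ and a one-way LOCC map $\Lambda:AB\to A'B'$ with $F(\Lambda(\rho^{AB}),\Psi_M^{A'B'})\ge 1-\varepsilon$; the one-shot one-way distillable entanglement $E_D^{\rightarrow}(\rho^{AB};\varepsilon)\in[0,+\infty]$ is the supremum of the $\varepsilon$-achievable rates. **Lemma (One-Shot Hashing Bound).** For every state $\rho^{AB}$ and every $\varepsilon\ge 0$, with $d_A=\dim\mathscr H_A$, there is $\Delta\in[0,1]$ such that $$E_D^{\rightarrow}(\rho^{AB};\varepsilon)\ \ge\ I_{0,\varepsilon/8}^{A\to B}(\rho^{AB})+\log\Bigl[\frac1{d_A}+\frac{\varepsilon^2}{4}\Bigr]-\Delta .$$ More precisely, put $r=I_{0,\varepsilon/8}^{A\to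 B}(\rho^{AB})+\log[\frac1{d_A}+\frac{\varepsilon^2}4]$. If $0\le r<\infty$, then $\Delta$ is the smallest nonnegative real number for which $r-\Delta$ is the logarithm of a positive integer; if $r<0$, then $\Delta=0$. -/

import Mathlib

open scoped Kronecker MatrixOrder ComplexOrder

noncomputable section

namespace OneShot

/-- Density operators (states) on the finite-dimensional Hilbert space with orthonormal basis
indexed by `A`: positive semidefinite matrices of unit trace. -/
def IsState {A : Type*} [Fintype A] (ρ : Matrix A A ℂ) : Prop :=
  ρ.PosSemidef ∧ ρ.trace = 1

/-- The fidelity `F(ρ, σ) = Tr √(√ρ σ √ρ)` of two positive semidefinite matrices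
(not necessarily normalized, no square). -/
def fidelity {A : Type*} [Fintype A] [DecidableEq A] (ρ σ : Matrix A A ℂ) : ℝ :=
  (CFC.sqrt (CFC.sqrt ρ * σ * CFC.sqrt ρ)).trace.re

/-- The ball of subnormalized states `σ` with `F(ρ, σ)² ≥ 1 - δ²`. -/
def ball {A : Type*} [Fintype A] [DecidableEq A] (ρ : Matrix A A ℂ) (δ : ℝ) :
    Set (Matrix A A ℂ) :=
  {σ | σ.PosSemidef ∧ σ.trace.re ≤ 1 ∧ 1 - δ ^ 2 ≤ fidelity ρ σ ^ 2}

/-- The matrix of the orthogonal projector onto the support of `ρ`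
(its range, `ρ` being positive semidefinite). -/
def suppProj {A : Type*} [Fintype A] [DecidableEq A] (ρ : Matrix A A ℂ) : Matrix A A ℂ :=
  Matrix.toEuclideanLin.symm
    ((LinearMap.range (Matrix.toEuclideanLin ρ)).starProjection : EuclideanSpace ℂ A →ₗ[ℂ] _)

/-- The relative Rényi entropy of order zero, `S₀(ρ‖σ) = -log₂ Tr[Π_ρ σ]`,
equal to `+∞` if `Tr[Π_ρ σ] = 0`. -/
def relRenyiZero {A : Type*} [Fintype A] [DecidableEq A] (ρ σ : Matrix A A ℂ) : EReal :=
  if 0 < (suppProj ρ * σ).trace.re then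
    ((-Real.logb 2 (suppProj ρ * σ).trace.re : ℝ) : EReal)
  else ⊤

/-- The smoothed zero-coherent information `I_{0,δ}^{A→B}(ρ)`: the maximum over `ρ'` in the
ball of radius `δ` around `ρ` of the minimum over states `σ` on `B` of `S₀(ρ' ‖ 1_A ⊗ σ)`. -/
def smoothZeroCoherentInfo {A B : Type*} [Fintype A] [DecidableEq A] [Fintype B] [DecidableEq B]
    (ρ : Matrix (A × B) (A × B) ℂ) (δ : ℝ) : EReal :=
  ⨆ ρ' ∈ ball ρ δ, ⨅ σ ∈ {σ : Matrix B B ℂ | IsState σ},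
    relRenyiZero ρ' ((1 : Matrix A A ℂ) ⊗ₖ σ)

/-- The tensor product `Φ ⊗ Ψ` of linear maps of matrices: the linear map with
`X ⊗ₖ Y ↦ Φ X ⊗ₖ Ψ Y`. -/
def tensorMap {A B C D : Type*} [Fintype A] [DecidableEq A] [Fintype B] [DecidableEq B]
    (Φ : Matrix A A ℂ →ₗ[ℂ] Matrix C C ℂ) (Ψ : Matrix B B ℂ →ₗ[ℂ] Matrix D D ℂ) :
    Matrix (A × B) (A × B) ℂ →ₗ[ℂ] Matrix (C × D) (C × D) ℂ where
  toFun X := ∑ a, ∑ a', ∑ b, ∑ b',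
    X (a, b) (a', b') • (Φ (Matrix.single a a' 1) ⊗ₖ Ψ (Matrix.single b b' 1))
  map_add' X Y := by
    simp only [Matrix.add_apply, add_smul, Finset.sum_add_distrib]
  map_smul' c X := by
    simp only [Matrix.smul_apply, smul_eq_mul, mul_smul, Finset.smul_sum, RingHom.id_apply]

/-- Complete positivity: `Φ ⊗ id_n` preserves positive semidefiniteness for every `n`. -/
def IsCompletelyPositive {A C : Type*} [Fintype A] [DecidableEq A] [Fintype C]
    (Φ : Matrix A A ℂ →ₗ[ℂ] Matrix C C ℂ) : Prop :=
  ∀ (n : ℕ) (X : Matrix (A × Fin n) (A × Fin n) ℂ), X.PosSemidef →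
    (tensorMap Φ (LinearMap.id : Matrix (Fin n) (Fin n) ℂ →ₗ[ℂ] _) X).PosSemidef

/-- `Φ` preserves the trace. -/
def IsTracePreserving {A C : Type*} [Fintype A] [Fintype C]
    (Φ : Matrix A A ℂ →ₗ[ℂ] Matrix C C ℂ) : Prop :=
  ∀ X, (Φ X).trace = X.trace

/-- One-way (forward, from Alice to Bob) LOCC maps: Alice applies a completely positive
instrument `(E x)`, sends the outcome `x` to Bob, who applies a completely positive,
trace-preserving map `D x`. -/
def IsOneWayLOCC {A B C D : Type*} [Fintype A] [DecidableEq A] [Fintype B] [DecidableEq B]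
    [Fintype C] [Fintype D]
    (Λ : Matrix (A × B) (A × B) ℂ →ₗ[ℂ] Matrix (C × D) (C × D) ℂ) : Prop :=
  ∃ (n : ℕ) (E : Fin n → (Matrix A A ℂ →ₗ[ℂ] Matrix C C ℂ))
    (F : Fin n → (Matrix B B ℂ →ₗ[ℂ] Matrix D D ℂ)),
    (∀ x, IsCompletelyPositive (E x)) ∧ IsTracePreserving (∑ x, E x) ∧
    (∀ x, IsCompletelyPositive (F x) ∧ IsTracePreserving (F x)) ∧
    Λ = ∑ x, tensorMap (E x) (F x)

/-- `Ψ` is (the projector onto) a maximally entangled state of rank `M`, that is, onto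
`M^(-1/2) ∑_{i < M} e i ⊗ f i` for some orthonormal bases `e` and `f` and `1 ≤ M ≤ d`. -/
def IsMaxEntangled {d : ℕ} (M : ℕ) (Ψ : Matrix (Fin d × Fin d) (Fin d × Fin d) ℂ) : Prop :=
  1 ≤ M ∧ M ≤ d ∧
  ∃ (e f : OrthonormalBasis (Fin d) ℂ (EuclideanSpace ℂ (Fin d)))
    (ψ : Fin d × Fin d → ℂ),
    (∀ p, ψ p = ((1 / √(M : ℝ) : ℝ) : ℂ) *
      ∑ i ∈ Finset.univ.filter (fun i : Fin d => i.val < M), e i p.1 * f i p.2) ∧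
    Ψ = Matrix.vecMulVec ψ (star ψ)

/-- `R ≥ 0` is an `ε`-achievable rate for one-way entanglement distillation from `ρ`. -/
def IsAchievableRate {A B : Type*} [Fintype A] [DecidableEq A] [Fintype B] [DecidableEq B]
    (ρ : Matrix (A × B) (A × B) ℂ) (ε R : ℝ) : Prop :=
  0 ≤ R ∧ ∃ (M d : ℕ) (Ψ : Matrix (Fin d × Fin d) (Fin d × Fin d) ℂ)
    (Λ : Matrix (A × B) (A × B) ℂ →ₗ[ℂ] Matrix (Fin d × Fin d) (Fin d × Fin d) ℂ),
    (2 : ℝ) ^ R ≤ M ∧ IsMaxEntangled M Ψ ∧ IsOneWayLOCC Λ ∧ 1 - ε ≤ fidelity (Λ ρ) Ψ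

/-- The one-shot distillable entanglement under one-way LOCC: the supremum of all
`ε`-achievable rates (`+∞` if these are unbounded). -/
def oneWayDistillable {A B : Type*} [Fintype A] [DecidableEq A] [Fintype B] [DecidableEq B]
    (ρ : Matrix (A × B) (A × B) ℂ) (ε : ℝ) : EReal :=
  sSup ((fun R : ℝ => (R : EReal)) '' {R | IsAchievableRate ρ ε R})

end OneShot

end

/-! The proof is a random-coding argument with an explicit decoder. Fix `ρ'` in the ball with
support projector `P`, and suppose `Tr[P (1 ⊗ σ)] ≤ lam` for all states `σ`. Alice measures with the
`m × d_A` matrices `K` whose entries are cube-root-of-unity phases over `√m`, uniformly weighted.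
Their Gram matrices `G = K†K` average to the identity, so this is an instrument. Knowing `K`, Bob
applies a pretty-good decoder normalized by `T`, an inverse square root of `S = Tr_A[K P K†]`.

The decoder contributes overlap `m⁻¹ Tr[ρ' (G ⊗ T) P (G ⊗ T)]` with the maximally entangled vector.
Two convexity bounds make it linear in `S`: positivity of `(X - √m) P (X - √m)` for `X = G ⊗ T`, and
the tangent to `s ↦ 1/√s` at `1/m`. The average then involves only the first two moments of `G`,
which are exact, and is at least `Tr ρ' · (1 - m lam)` (`exists_protocol`). All outcomes of `K`
belong to one instrument, so the average is itself the performance of one protocol and nothing has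
to be derandomized.

The passage from `ρ'` to the true state `ρ` treats "protocol, then test for the target" as a
two-outcome measurement. `fidelity_le_measurement` turns closeness of `ρ` and `ρ'` together with a
small failure probability on `ρ'` into fidelity at least `1 - ε` (`isAchievableRate_logb`).

The term `1/d_A` costs nothing: pinching gives `lam ≥ 1/d_A`, so for `m ≥ 2` it can be absorbed into
`m lam`, leaving `m lam` of order `ε²`. The case `m = 1` is trivial, and for `ε ≥ 1` every rate is
achievable. -/

namespace OneShot

open Matrix

/-! ### Trace inequalities, inverse square roots and fidelity -/

section Analysis

variable {n m : Type*} [Fintype n] [Fintype m]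

lemma re_trace_conjTranspose_mul_self (X : Matrix m n ℂ) :
    (Xᴴ * X).trace.re = ∑ i, ∑ j, ‖X i j‖ ^ 2 := by
  simp only [trace, diag_apply, mul_apply, conjTranspose_apply, Complex.re_sum]
  rw [Finset.sum_comm]
  refine Finset.sum_congr rfl fun i _ => Finset.sum_congr rfl fun j _ => ?_
  rw [Complex.star_def, Complex.conj_mul']
  norm_cast

/-- The Cauchy-Schwarz inequality for the Hilbert-Schmidt inner product. -/
lemma norm_trace_conjTranspose_mul_le (X Y : Matrix m n ℂ) :
    ‖(Xᴴ * Y).trace‖ ≤ √((Xᴴ * X).trace.re) * √((Yᴴ * Y).trace.re) := by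
  rw [re_trace_conjTranspose_mul_self, re_trace_conjTranspose_mul_self,
    ← Fintype.sum_prod_type' (f := fun i j => ‖X i j‖ ^ 2),
    ← Fintype.sum_prod_type' (f := fun i j => ‖Y i j‖ ^ 2)]
  refine le_trans ?_ (Real.sum_mul_le_sqrt_mul_sqrt _ _ _)
  simp only [trace, diag_apply, mul_apply, conjTranspose_apply]
  rw [Finset.sum_comm, ← Fintype.sum_prod_type' (f := fun i j => star (X i j) * Y i j)]
  refine (norm_sum_le _ _).trans (le_of_eq ?_)
  simp

lemma re_trace_nonneg {X : Matrix n n ℂ} (hX : X.PosSemidef) : 0 ≤ X.trace.re :=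
  (Complex.nonneg_iff.mp hX.trace_nonneg).1

lemma exists_conjTranspose_mul_self [DecidableEq n] {X : Matrix n n ℂ} (hX : X.PosSemidef) :
    ∃ Y : Matrix n n ℂ, X = Yᴴ * Y :=
  ⟨CFC.sqrt X, by
    have h := (nonneg_iff_posSemidef.mp (CFC.sqrt_nonneg X)).isHermitian
    rw [h.eq, CFC.sqrt_mul_sqrt_self X (nonneg_iff_posSemidef.mpr hX)]⟩

lemma re_trace_mul_nonneg [DecidableEq n] {X Y : Matrix n n ℂ} (hX : X.PosSemidef)
    (hY : Y.PosSemidef) : 0 ≤ (X * Y).trace.re := by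
  obtain ⟨Z, rfl⟩ := exists_conjTranspose_mul_self hX
  rw [Matrix.mul_assoc, trace_mul_comm]
  exact re_trace_nonneg (hY.mul_mul_conjTranspose_same Z)

lemma re_trace_mul_mono [DecidableEq n] {X Y Z : Matrix n n ℂ} (hX : X.PosSemidef)
    (h : Y ≤ Z) : (X * Y).trace.re ≤ (X * Z).trace.re := by
  have := re_trace_mul_nonneg hX (le_iff.mp h)
  rwa [Matrix.mul_sub, trace_sub, Complex.sub_re, sub_nonneg] at this

/-- A regularized inverse square root: `W` inverts `√H` on the support of `H`, and lies above the
tangent at `α⁻²` of the convex function `s ↦ 1 / √s`. -/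
lemma exists_invSqrt [DecidableEq n] {H : Matrix n n ℂ} (hH : H.PosSemidef) {α : ℝ}
    (hα : 0 ≤ α) :
    ∃ W : Matrix n n ℂ, W.PosSemidef ∧ W * H = CFC.sqrt H ∧ W * H * W ≤ 1 ∧
      (3 / 2 * α) • (1 : Matrix n n ℂ) - (α ^ 3 / 2) • H ≤ W := by
  have h0 : 0 ≤ H := nonneg_iff_posSemidef.mpr hH
  have hsa : IsSelfAdjoint H := hH.isHermitian.isSelfAdjoint
  have hspec : ∀ x ∈ spectrum ℝ H, 0 ≤ x := fun x hx => spectrum_nonneg_of_nonneg h0 hx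
  have hcont : ∀ g : ℝ → ℝ, ContinuousOn g (spectrum ℝ H) := fun g =>
    (Matrix.finite_real_spectrum (A := H)).continuousOn g
  -- The value at `0` does not affect `W * H`; it is the height of the tangent line there, so the
  -- lower bound also holds on the kernel.
  set f : ℝ → ℝ := fun s => if s = 0 then 3 / 2 * α else 1 / √s with hf
  have hf0 : ∀ s, 0 ≤ f s := fun s => by
    simp only [hf]; split_ifs <;> positivity
  have hmul : cfc f H * H = cfc (fun s => √s) H := by
    have hid : cfc f H * H = cfc f H * cfc (fun x : ℝ => x) H := by rw [cfc_id' ℝ H]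
    rw [hid, ← cfc_mul f (fun x => x) H (hcont _) (hcont _)]
    refine cfc_congr fun s hs => ?_
    have := hspec s hs
    simp only [hf]
    split_ifs with h
    · simp [h]
    · have h1 : √s ≠ 0 := by
        rw [Ne, Real.sqrt_eq_zero this]; exact h
      field_simp
      rw [Real.sq_sqrt this]
  refine ⟨cfc f H, nonneg_iff_posSemidef.mp (cfc_nonneg fun x _ => hf0 x), ?_, ?_, ?_⟩
  · rw [hmul, eq_comm]
    refine CFC.sqrt_unique ?_ (cfc_nonneg fun x _ => Real.sqrt_nonneg x)
    rw [← cfc_mul _ _ H (hcont _) (hcont _)]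
    conv_rhs => rw [← cfc_id' ℝ H]
    exact cfc_congr fun s hs => Real.mul_self_sqrt (hspec s hs)
  · rw [hmul, ← cfc_mul _ _ H (hcont _) (hcont _)]
    refine cfc_le_one _ _ fun s hs => ?_
    simp only [hf]
    split_ifs with h
    · simp [h]
    · rw [mul_one_div, div_self]
      rw [Ne, Real.sqrt_eq_zero (hspec s hs)]; exact h
  · have : (3 / 2 * α) • (1 : Matrix n n ℂ) - (α ^ 3 / 2) • H
        = cfc (fun s : ℝ => 3 / 2 * α - α ^ 3 / 2 * s) H := by
      rw [cfc_sub _ _ H (hcont _) (hcont _), cfc_const _ H, cfc_const_mul_id _ H,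
        Algebra.algebraMap_eq_smul_one]
    rw [this]
    refine cfc_mono (fun s hs => ?_) (hcont _) (hcont _)
    simp only [hf]
    split_ifs with h
    · simp [h]
    · have hs0 := hspec s hs
      have hpos : 0 < √s := Real.sqrt_pos.mpr (lt_of_le_of_ne hs0 (Ne.symm h))
      rw [le_div_iff₀ hpos]
      obtain ⟨x, hx⟩ : ∃ x, x = √s := ⟨_, rfl⟩
      have hsx : s = x ^ 2 := by rw [hx, Real.sq_sqrt hs0]
      rw [← hx] at hpos ⊢
      rw [hsx]
      -- With `y = αx` the claim is `y³ - 3y + 2 = (y - 1)²(y + 2) ≥ 0`.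
      nlinarith [mul_nonneg (sq_nonneg (α * x - 1)) (by positivity : 0 ≤ α * x + 2)]

variable [DecidableEq n]

lemma fidelity_nonneg (ρ σ : Matrix n n ℂ) : 0 ≤ fidelity ρ σ :=
  re_trace_nonneg (nonneg_iff_posSemidef.mp (CFC.sqrt_nonneg _))

lemma sqrt_isHermitian (ρ : Matrix n n ℂ) : (CFC.sqrt ρ).IsHermitian :=
  (nonneg_iff_posSemidef.mp (CFC.sqrt_nonneg ρ)).isHermitian

/-- A two-outcome measurement bound on the fidelity. -/
lemma fidelity_le_measurement {ρ σ Ω : Matrix n n ℂ} (hρ : ρ.PosSemidef) (hσ : σ.PosSemidef)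
    (hΩ : Ω.PosSemidef) (hΩ' : (1 - Ω).PosSemidef) :
    fidelity ρ σ ≤ √((ρ * Ω).trace.re) * √((σ * Ω).trace.re)
      + √((ρ * (1 - Ω)).trace.re) * √((σ * (1 - Ω)).trace.re) := by
  have hr := sqrt_isHermitian ρ
  have hs := sqrt_isHermitian σ
  have hrr : CFC.sqrt ρ * CFC.sqrt ρ = ρ :=
    CFC.sqrt_mul_sqrt_self ρ (nonneg_iff_posSemidef.mpr hρ)
  have hss : CFC.sqrt σ * CFC.sqrt σ = σ :=
    CFC.sqrt_mul_sqrt_self σ (nonneg_iff_posSemidef.mpr hσ)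
  set r := CFC.sqrt ρ with hrdef
  set s := CFC.sqrt σ with hsdef
  have hH : (r * σ * r).PosSemidef := by
    have := hσ.mul_mul_conjTranspose_same r
    rwa [hr.eq] at this
  obtain ⟨W, hW, hWH, hWHW, -⟩ := exists_invSqrt hH le_rfl
  have hWh := hW.isHermitian
  -- `V` is a contraction playing the role of the polar part of `√ρ √σ`: inserted between the two
  -- roots it realizes the fidelity as a trace, which can then be split by `Ω` and `1 - Ω`.
  set V := W * r * s with hV
  have hVV : V * Vᴴ ≤ 1 := by
    have : V * Vᴴ = W * (r * σ * r) * W := by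
      simp only [hV, conjTranspose_mul, hWh.eq, hr.eq, hs.eq, ← hss, Matrix.mul_assoc]
    rw [this]; exact hWHW
  have hF : fidelity ρ σ = (r * V * s).trace.re := by
    unfold fidelity
    rw [← hrdef, ← hWH]
    congr 1
    rw [Matrix.mul_assoc r V s, trace_mul_comm r]
    simp only [hV, ← hss, Matrix.mul_assoc]
  have key : ∀ P : Matrix n n ℂ, P.PosSemidef →
      (r * V * s * P).trace.re ≤ √((ρ * P).trace.re) * √((σ * P).trace.re) := by
    intro P hP
    obtain ⟨Z, rfl⟩ := exists_conjTranspose_mul_self hP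
    have h1 : (r * V * s * (Zᴴ * Z)).trace = (((Z * r * V)ᴴ)ᴴ * (Z * s)ᴴ).trace := by
      rw [conjTranspose_conjTranspose, conjTranspose_mul, hs.eq, ← Matrix.mul_assoc,
        trace_mul_comm]
      simp only [Matrix.mul_assoc]
    rw [h1]
    refine (Complex.re_le_norm _).trans ((norm_trace_conjTranspose_mul_le _ _).trans ?_)
    refine mul_le_mul (Real.sqrt_le_sqrt ?_) (Real.sqrt_le_sqrt (le_of_eq ?_))
      (Real.sqrt_nonneg _) (Real.sqrt_nonneg _)
    · have e1 : (((Z * r * V)ᴴ)ᴴ * (Z * r * V)ᴴ).trace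
          = (((Z * r)ᴴ * (Z * r)) * (V * Vᴴ)).trace := by
        rw [conjTranspose_conjTranspose, conjTranspose_mul, Matrix.mul_assoc (Z * r),
          trace_mul_comm, trace_mul_comm _ (V * Vᴴ)]
        simp only [Matrix.mul_assoc]
      have e2 : (ρ * (Zᴴ * Z)).trace = (((Z * r)ᴴ * (Z * r)) * 1).trace := by
        rw [Matrix.mul_one, conjTranspose_mul, hr.eq, ← hrr, Matrix.mul_assoc r r,
          trace_mul_comm r]
        simp only [Matrix.mul_assoc]
      rw [e1, e2]
      exact re_trace_mul_mono (posSemidef_conjTranspose_mul_self _) hVV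
    · rw [conjTranspose_conjTranspose, conjTranspose_mul, hs.eq, ← hss, trace_mul_comm]
      congr 1
      rw [trace_mul_comm]
      simp only [Matrix.mul_assoc]
      rw [trace_mul_comm]
      simp only [Matrix.mul_assoc]
  have hsum : r * V * s = r * V * s * Ω + r * V * s * (1 - Ω) := by
    rw [← Matrix.mul_add]; simp
  rw [hF, hsum, trace_add, Complex.add_re]
  exact add_le_add (key Ω hΩ) (key _ hΩ')

omit [DecidableEq n] in
lemma trace_vecMulVec_star (φ : n → ℂ) :
    (vecMulVec φ (star φ)).trace = ((vecMulVec φ (star φ)).trace.re : ℂ) := by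
  have := (Complex.nonneg_iff.mp (posSemidef_vecMulVec_self_star φ).trace_nonneg).2
  exact Complex.ext (by simp) (by rw [← this]; simp)

omit [DecidableEq n] in
lemma vecMulVec_star_mul_self (φ : n → ℂ) :
    vecMulVec φ (star φ) * vecMulVec φ (star φ)
      = ((vecMulVec φ (star φ)).trace.re) • vecMulVec φ (star φ) := by
  rw [vecMulVec_mul_vecMulVec, dotProduct_comm, ← trace_vecMulVec, trace_vecMulVec_star]
  ext i j
  simp only [Matrix.smul_apply, vecMulVec_apply, Pi.smul_apply, Complex.real_smul, smul_eq_mul,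
    Complex.ofReal_re]
  ring

lemma sqrt_vecMulVec_star {φ : n → ℂ} (h : 0 < (vecMulVec φ (star φ)).trace.re) :
    CFC.sqrt (vecMulVec φ (star φ))
      = (√((vecMulVec φ (star φ)).trace.re))⁻¹ • vecMulVec φ (star φ) := by
  refine CFC.sqrt_unique ?_ (nonneg_iff_posSemidef.mpr
    ((posSemidef_vecMulVec_self_star φ).smul (by positivity)))
  rw [smul_mul_smul_comm, vecMulVec_star_mul_self, smul_smul, ← mul_inv,
    Real.mul_self_sqrt h.le, inv_mul_cancel₀ h.ne', one_smul]

/-- The fidelity with the projector onto a vector. -/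
lemma sqrt_re_trace_le_fidelity {ρ : Matrix n n ℂ} (hρ : ρ.PosSemidef) (ψ : n → ℂ) :
    √((ρ * vecMulVec ψ (star ψ)).trace.re) ≤ fidelity ρ (vecMulVec ψ (star ψ)) := by
  have hr := sqrt_isHermitian ρ
  have hrr : CFC.sqrt ρ * CFC.sqrt ρ = ρ :=
    CFC.sqrt_mul_sqrt_self ρ (nonneg_iff_posSemidef.mpr hρ)
  unfold fidelity
  set r := CFC.sqrt ρ
  -- Conjugating by `√ρ` keeps the projector rank one, so its square root is explicit.
  set φ := r *ᵥ ψ with hφ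
  have e : r * vecMulVec ψ (star ψ) * r = vecMulVec φ (star φ) := by
    rw [mul_vecMulVec, vecMulVec_mul, hφ, star_mulVec, hr.eq]
  have e2 : (ρ * vecMulVec ψ (star ψ)).trace = (vecMulVec φ (star φ)).trace := by
    rw [← e, trace_mul_comm (r * _), ← Matrix.mul_assoc, hrr]
  rw [e, e2]
  have hN0 := re_trace_nonneg (posSemidef_vecMulVec_self_star φ)
  rcases eq_or_lt_of_le hN0 with h | h
  · rw [← h, Real.sqrt_zero]
    exact re_trace_nonneg (nonneg_iff_posSemidef.mp (CFC.sqrt_nonneg (vecMulVec φ (star φ))))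
  have hsq := sqrt_vecMulVec_star h
  generalize vecMulVec φ (star φ) = P at *
  rw [hsq, trace_smul, Complex.real_smul, Complex.re_ofReal_mul, ← div_eq_inv_mul, Real.div_sqrt]

end Analysis

/-! ### Kraus maps and one-way LOCC -/

section Channels

variable {A B C D : Type*} [Fintype A] [DecidableEq A] [Fintype B] [DecidableEq B]
  [Fintype C] [Fintype D]

/-- The completely positive map with Kraus operators `K`. -/
noncomputable def krausMap {ι A C : Type*} [Fintype ι] [Fintype A] (K : ι → Matrix C A ℂ) :
    Matrix A A ℂ →ₗ[ℂ] Matrix C C ℂ where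
  toFun X := ∑ k, K k * X * (K k)ᴴ
  map_add' X Y := by
    simp only [Matrix.mul_add, Matrix.add_mul, Finset.sum_add_distrib]
  map_smul' c X := by
    simp only [Matrix.mul_smul, Matrix.smul_mul, Finset.smul_sum, RingHom.id_apply]

omit [DecidableEq A] [Fintype C] in
lemma krausMap_apply {ι : Type*} [Fintype ι] (K : ι → Matrix C A ℂ) (X : Matrix A A ℂ) :
    krausMap K X = ∑ k, K k * X * (K k)ᴴ := rfl

omit [Fintype C] [Fintype D] in
lemma tensorMap_single (Φ : Matrix A A ℂ →ₗ[ℂ] Matrix C C ℂ)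
    (Ψ : Matrix B B ℂ →ₗ[ℂ] Matrix D D ℂ) (a a' : A) (b b' : B) :
    tensorMap Φ Ψ (single (a, b) (a', b') 1) = Φ (single a a' 1) ⊗ₖ Ψ (single b b' 1) := by
  change (∑ x, ∑ x', ∑ y, ∑ y', (single (a, b) (a', b') (1 : ℂ)) (x, y) (x', y') •
    (Φ (single x x' 1) ⊗ₖ Ψ (single y y' 1))) = _
  rw [Finset.sum_eq_single a (fun x _ hx => ?_) (by simp),
    Finset.sum_eq_single a' (fun x _ hx => ?_) (by simp),
    Finset.sum_eq_single b (fun x _ hx => ?_) (by simp),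
    Finset.sum_eq_single b' (fun x _ hx => ?_) (by simp)]
  · simp
  · simp [hx.symm]
  · simp [hx.symm]
  · simp [hx.symm]
  · simp [hx.symm]

omit [Fintype C] [Fintype D] in
lemma tensorMap_krausMap {ι κ : Type*} [Fintype ι] [Fintype κ] (K : ι → Matrix C A ℂ)
    (L : κ → Matrix D B ℂ) :
    tensorMap (krausMap K) (krausMap L) = krausMap (fun p : ι × κ => K p.1 ⊗ₖ L p.2) := by
  refine ext_linearMap ℂ fun p q => LinearMap.ext_ring ?_
  obtain ⟨a, b⟩ := p
  obtain ⟨a', b'⟩ := q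
  have hs : single (a, b) (a', b') (1 : ℂ) = single a a' 1 ⊗ₖ single b b' 1 := by
    rw [single_kronecker_single, one_mul]
  simp only [LinearMap.comp_apply, singleLinearMap_apply]
  change tensorMap _ _ (single (a, b) (a', b') 1) = krausMap _ (single (a, b) (a', b') 1)
  rw [tensorMap_single, hs]
  simp only [krausMap_apply, conjTranspose_kronecker, ← mul_kronecker_mul, Fintype.sum_prod_type]
  ext i j
  simp only [kroneckerMap_apply, Matrix.sum_apply, Finset.sum_mul_sum]

lemma krausMap_id [DecidableEq C] :
    (LinearMap.id : Matrix C C ℂ →ₗ[ℂ] Matrix C C ℂ) = krausMap (fun _ : Unit => 1) := by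
  ext1; simp [krausMap_apply]

omit [DecidableEq A] in
lemma posSemidef_krausMap {ι : Type*} [Fintype ι] (K : ι → Matrix C A ℂ) {X : Matrix A A ℂ}
    (hX : X.PosSemidef) : (krausMap K X).PosSemidef := by
  rw [krausMap_apply]
  exact posSemidef_sum _ fun k _ => hX.mul_mul_conjTranspose_same (K k)

lemma isCompletelyPositive_krausMap {ι : Type*} [Fintype ι] (K : ι → Matrix C A ℂ) :
    IsCompletelyPositive (krausMap K) := by
  intro n X hX
  rw [krausMap_id, tensorMap_krausMap]
  exact posSemidef_krausMap _ hX

omit [DecidableEq A] in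
lemma trace_krausMap {ι : Type*} [Fintype ι] (K : ι → Matrix C A ℂ) (X : Matrix A A ℂ) :
    (krausMap K X).trace = ((∑ k, (K k)ᴴ * K k) * X).trace := by
  simp only [krausMap_apply, trace_sum, Finset.sum_mul, Matrix.mul_assoc]
  refine Finset.sum_congr rfl fun k _ => ?_
  rw [← Matrix.mul_assoc, trace_mul_comm]

lemma isTracePreserving_krausMap {ι : Type*} [Fintype ι] {K : ι → Matrix C A ℂ}
    (hK : ∑ k, (K k)ᴴ * K k = 1) : IsTracePreserving (krausMap K) := by
  intro X
  rw [trace_krausMap, hK, Matrix.one_mul]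

/-- The one-way LOCC map in which Alice's instrument has one Kraus operator per outcome. -/
lemma isOneWayLOCC_krausMap {ι κ : Type*} [Fintype ι] [Fintype κ] {K : ι → Matrix C A ℂ}
    {L : ι → κ → Matrix D B ℂ} (hK : ∑ x, (K x)ᴴ * K x = 1)
    (hL : ∀ x, ∑ k, (L x k)ᴴ * L x k = 1) :
    IsOneWayLOCC (krausMap (fun p : ι × κ => K p.1 ⊗ₖ L p.1 p.2)) := by
  set e := (Fintype.equivFin ι).symm
  refine ⟨Fintype.card ι, fun x => krausMap (fun _ : Unit => K (e x)),
    fun x => krausMap (L (e x)), fun x => isCompletelyPositive_krausMap _, ?_,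
    fun x => ⟨isCompletelyPositive_krausMap _, isTracePreserving_krausMap (hL _)⟩, ?_⟩
  · rw [Equiv.sum_comp e (fun x => krausMap (fun _ : Unit => K x))]
    have : ∑ x, krausMap (fun _ : Unit => K x) = krausMap K := by
      refine LinearMap.ext fun X => ?_
      simp [krausMap_apply]
    rw [this]
    exact isTracePreserving_krausMap hK
  · rw [Equiv.sum_comp e (fun x => tensorMap (krausMap (fun _ : Unit => K x)) (krausMap (L x)))]
    refine LinearMap.ext fun X => ?_
    simp [tensorMap_krausMap, krausMap_apply, Fintype.sum_prod_type]

omit [Fintype A] [Fintype B] in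
lemma sum_kronecker_conjTranspose_mul_self {ι κ : Type*} [Fintype ι] [Fintype κ]
    {K : ι → Matrix C A ℂ} {L : ι → κ → Matrix D B ℂ} (hK : ∑ x, (K x)ᴴ * K x = 1)
    (hL : ∀ x, ∑ k, (L x k)ᴴ * L x k = 1) :
    ∑ p : ι × κ, (K p.1 ⊗ₖ L p.1 p.2)ᴴ * (K p.1 ⊗ₖ L p.1 p.2) = 1 := by
  rw [Fintype.sum_prod_type]
  simp only [conjTranspose_kronecker, ← mul_kronecker_mul]
  have h1 : ∀ x, ∑ k, ((K x)ᴴ * K x) ⊗ₖ ((L x k)ᴴ * L x k)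
      = ((K x)ᴴ * K x) ⊗ₖ (1 : Matrix B B ℂ) := by
    intro x
    rw [← hL x]
    ext i j
    simp only [Matrix.sum_apply, kroneckerMap_apply, Finset.mul_sum]
  have h2 : ∑ x, ((K x)ᴴ * K x) ⊗ₖ (1 : Matrix B B ℂ)
      = (∑ x, (K x)ᴴ * K x) ⊗ₖ (1 : Matrix B B ℂ) := by
    ext i j
    simp only [Matrix.sum_apply, kroneckerMap_apply, Finset.sum_mul]
  simp only [h1]
  rw [h2, hK, one_kronecker_one]

lemma sum_single_diag (i : C) [DecidableEq C] :
    ∑ b : B, (single i b (1 : ℂ))ᴴ * single i b (1 : ℂ) = 1 := by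
  simp only [conjTranspose_single, single_mul_single_same, star_one, one_mul]
  ext x y
  simp [Matrix.sum_apply, single_apply, one_apply, ite_and]

/-- The protocol that discards the input and prepares a product state. -/
lemma exists_trivial_protocol (A B : Type*) [Fintype A] [DecidableEq A] [Fintype B]
    [DecidableEq B] {m : ℕ} (hm : m ≠ 0) :
    ∃ M : A × B → Matrix (Fin m × Fin m) (A × B) ℂ,
      ∑ p, (M p)ᴴ * M p = 1 ∧ IsOneWayLOCC (krausMap M) := by
  have i₀ : Fin m := ⟨0, Nat.pos_of_ne_zero hm⟩
  obtain ⟨K, hK⟩ : ∃ K : A → Matrix (Fin m) A ℂ, ∑ a, (K a)ᴴ * K a = 1 :=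
    ⟨_, sum_single_diag i₀⟩
  obtain ⟨L, hL⟩ : ∃ L : B → Matrix (Fin m) B ℂ, ∑ b, (L b)ᴴ * L b = 1 :=
    ⟨_, sum_single_diag i₀⟩
  exact ⟨fun p => K p.1 ⊗ₖ L p.2,
    sum_kronecker_conjTranspose_mul_self (L := fun _ : A => L) hK fun _ => hL,
    isOneWayLOCC_krausMap (L := fun _ : A => L) hK fun _ => hL⟩

end Channels

/-! ### Support projectors -/

section Support

variable {n : Type*} [Fintype n] [DecidableEq n] (ρ : Matrix n n ℂ)

lemma toEuclideanLin_suppProj :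
    Matrix.toEuclideanLin (suppProj ρ)
      = ((LinearMap.range (Matrix.toEuclideanLin ρ)).starProjection :
        EuclideanSpace ℂ n →ₗ[ℂ] EuclideanSpace ℂ n) :=
  Matrix.toEuclideanLin.apply_symm_apply _

lemma suppProj_mul_self : suppProj ρ * ρ = ρ := by
  apply Matrix.toEuclideanLin.injective
  rw [Matrix.toLpLin_mul_same, toEuclideanLin_suppProj]
  refine LinearMap.ext fun x => ?_
  exact Submodule.starProjection_eq_self_iff.mpr (LinearMap.mem_range_self _ x)

lemma suppProj_mul_suppProj : suppProj ρ * suppProj ρ = suppProj ρ := by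
  apply Matrix.toEuclideanLin.injective
  rw [Matrix.toLpLin_mul_same, toEuclideanLin_suppProj]
  refine LinearMap.ext fun x => ?_
  exact Submodule.starProjection_eq_self_iff.mpr (Submodule.starProjection_apply_mem _ x)

lemma suppProj_isHermitian : (suppProj ρ).IsHermitian := by
  rw [← Matrix.isSymmetric_toEuclideanLin_iff, toEuclideanLin_suppProj]
  exact Submodule.starProjection_isSymmetric _

lemma suppProj_posSemidef : (suppProj ρ).PosSemidef := by
  have := posSemidef_conjTranspose_mul_self (suppProj ρ)
  rwa [(suppProj_isHermitian ρ).eq, suppProj_mul_suppProj] at this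

lemma mul_suppProj_self (hρ : ρ.IsHermitian) : ρ * suppProj ρ = ρ := by
  have := congrArg conjTranspose (suppProj_mul_self ρ)
  rwa [conjTranspose_mul, hρ.eq, (suppProj_isHermitian ρ).eq] at this

end Support

/-! ### Moments of random phases -/

section Phases

variable {I : Type*} [Fintype I] [DecidableEq I]

lemma sum_stdAddChar_hom {V : Type*} [AddCommGroup V] [Fintype V] (l : V →+ ZMod 3) :
    ∑ θ, ZMod.stdAddChar (l θ) = if ∀ θ, l θ = 0 then (Fintype.card V : ℂ) else 0 := by
  classical
  have h := AddChar.sum_eq_ite ((ZMod.stdAddChar (N := 3)).compAddMonoidHom l)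
  simp only [AddChar.compAddMonoidHom_apply] at h
  rw [h]
  refine if_congr ⟨fun h θ => ?_, fun h => ?_⟩ rfl rfl
  · refine ZMod.injective_stdAddChar ?_
    have := DFunLike.congr_fun h θ
    simpa using this
  · ext θ
    simp [h θ]

/-- Fourth moments of independent uniform third roots of unity. -/
lemma sum_phases (s₁ s₂ s₃ s₄ : I) :
    ∑ θ : I → ZMod 3, ZMod.stdAddChar (θ s₁ - θ s₂ + θ s₃ - θ s₄)
      = if (s₁ = s₂ ∧ s₃ = s₄) ∨ (s₁ = s₄ ∧ s₂ = s₃) then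
        (Fintype.card (I → ZMod 3) : ℂ) else 0 := by
  let l : (I → ZMod 3) →+ ZMod 3 :=
    Pi.evalAddMonoidHom (fun _ => ZMod 3) s₁ - Pi.evalAddMonoidHom (fun _ => ZMod 3) s₂
      + Pi.evalAddMonoidHom (fun _ => ZMod 3) s₃ - Pi.evalAddMonoidHom (fun _ => ZMod 3) s₄
  rw [show (∑ θ : I → ZMod 3, ZMod.stdAddChar (θ s₁ - θ s₂ + θ s₃ - θ s₄))
    = ∑ θ, ZMod.stdAddChar (l θ) from rfl, sum_stdAddChar_hom]
  refine if_congr ⟨fun h => ?_, ?_⟩ rfl rfl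
  · have hs : ∀ s, (Pi.single s 1 : I → ZMod 3) s₁ - (Pi.single s 1 : I → ZMod 3) s₂
        + (Pi.single s 1 : I → ZMod 3) s₃ - (Pi.single s 1 : I → ZMod 3) s₄ = 0 :=
      fun s => h (Pi.single s 1)
    simp only [Pi.single_apply] at hs
    rcases eq_or_ne s₁ s₂ with rfl | e12
    · have h3 := hs s₃
      by_cases e34 : s₄ = s₃
      · exact Or.inl ⟨rfl, e34.symm⟩
      · simp [e34] at h3
    · have h1 := hs s₁
      have h2 := hs s₂
      have e14 : s₄ = s₁ := by
        by_contra e14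
        by_cases e13 : s₃ = s₁ <;> simp [e12.symm, e14, e13] at h1
        -- Here `s₃ = s₁`, and the coefficient `1 + 1` is nonzero modulo `3`. Signs would fail at
        -- this point: they allow the extra pairing `s₁ = s₃`, `s₂ = s₄`.
        revert h1; decide
      refine Or.inr ⟨e14.symm, ?_⟩
      by_contra e23
      simp [e12, e14, Ne.symm e23] at h2
  · rintro (⟨rfl, rfl⟩ | ⟨rfl, rfl⟩) θ
    · change θ s₁ - θ s₁ + θ s₃ - θ s₃ = 0; ring
    · change θ s₁ - θ s₂ + θ s₂ - θ s₁ = 0; ring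

end Phases

/-! ### Alice's random matrices and the moments of their Gram matrices -/

section RandomKraus

lemma inv_sqrt_mul_self (m : ℕ) :
    (((√(m : ℝ))⁻¹ : ℝ) : ℂ) * (((√(m : ℝ))⁻¹ : ℝ) : ℂ) = (m : ℂ)⁻¹ := by
  rw [← Complex.ofReal_mul, ← mul_inv, Real.mul_self_sqrt (Nat.cast_nonneg m)]
  push_cast; rfl

variable {A : Type*} [Fintype A] [DecidableEq A] {m : ℕ}

/-- The `m × A` matrix of phases `θ`, normalized so as to be an isometry on average. -/
noncomputable def phaseMatrix (θ : Fin m × A → ZMod 3) : Matrix (Fin m) A ℂ :=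
  of fun i a => ((√(m : ℝ))⁻¹ : ℝ) * ZMod.stdAddChar (θ (i, a))

/-- The Gram matrix of `phaseMatrix θ`. -/
noncomputable def phaseGram (θ : Fin m × A → ZMod 3) : Matrix A A ℂ :=
  (phaseMatrix θ)ᴴ * phaseMatrix θ

omit [Fintype A] [DecidableEq A] in
lemma phaseGram_apply (θ : Fin m × A → ZMod 3) (a' a : A) :
    phaseGram θ a' a = (m : ℂ)⁻¹ * ∑ i, ZMod.stdAddChar (θ (i, a) - θ (i, a')) := by
  simp only [phaseGram, phaseMatrix, mul_apply, conjTranspose_apply, of_apply, Finset.mul_sum]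
  refine Finset.sum_congr rfl fun i _ => ?_
  rw [sub_eq_add_neg, AddChar.map_add_eq_mul, AddChar.map_neg_eq_conj, star_mul', Complex.star_def,
    Complex.conj_ofReal, ← inv_sqrt_mul_self]
  ring

omit [Fintype A] in
-- Inclusion-exclusion over the two pairings. The second forces `i = j`, which is where the factor
-- `1/m` in the second moment comes from.
lemma ite_pairing (i j : Fin m) (a' a c' c : A) (N : ℂ) :
    (if ((i, a) = (i, a') ∧ (j, c) = (j, c')) ∨ ((i, a) = (j, c') ∧ (i, a') = (j, c)) then N else 0)
      = N * ((if a = a' ∧ c = c' then 1 else 0) + if i = j then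
          ((if a = c' ∧ a' = c then 1 else 0) - if a = c' ∧ a' = c ∧ a = a' then 1 else 0)
        else 0) := by
  simp only [Prod.mk.injEq, true_and]
  by_cases e1 : i = j <;> by_cases e2 : a = a' <;> by_cases e3 : c = c' <;>
    by_cases e4 : a = c' <;> by_cases e5 : a' = c <;> simp_all

lemma sum_phaseGram_mul (hm : m ≠ 0) (a' a c' c : A) :
    ∑ θ : Fin m × A → ZMod 3, phaseGram θ a' a * phaseGram θ c' c
      = (Fintype.card (Fin m × A → ZMod 3) : ℂ) *
        ((if a = a' ∧ c = c' then 1 else 0) + (m : ℂ)⁻¹ * ((if a = c' ∧ a' = c then 1 else 0)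
          - if a = c' ∧ a' = c ∧ a = a' then 1 else 0)) := by
  have hm' : (m : ℂ) ≠ 0 := by exact_mod_cast hm
  have h1 : ∀ θ : Fin m × A → ZMod 3, phaseGram θ a' a * phaseGram θ c' c
      = (m : ℂ)⁻¹ * (m : ℂ)⁻¹ *
        ∑ i, ∑ j, ZMod.stdAddChar (θ (i, a) - θ (i, a') + θ (j, c) - θ (j, c')) := by
    intro θ
    rw [phaseGram_apply, phaseGram_apply, mul_mul_mul_comm, Finset.sum_mul_sum]
    simp only [add_sub_assoc, AddChar.map_add_eq_mul]
  have h2 : ∑ θ : Fin m × A → ZMod 3,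
        ∑ i, ∑ j, ZMod.stdAddChar (θ (i, a) - θ (i, a') + θ (j, c) - θ (j, c'))
      = ∑ i : Fin m, ∑ j : Fin m, ∑ θ : Fin m × A → ZMod 3,
        ZMod.stdAddChar (θ (i, a) - θ (i, a') + θ (j, c) - θ (j, c')) := by
    rw [Finset.sum_comm]
    exact Finset.sum_congr rfl fun i _ => Finset.sum_comm
  simp only [h1, ← Finset.mul_sum, h2, sum_phases, ite_pairing]
  generalize (Fintype.card (Fin m × A → ZMod 3) : ℂ) = N
  simp only [Finset.sum_add_distrib, Finset.sum_ite_eq, Finset.mem_univ,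
    if_true, Finset.sum_const, Finset.card_univ, Fintype.card_fin, nsmul_eq_mul]
  field_simp

lemma sum_phaseGram (hm : m ≠ 0) :
    ∑ θ : Fin m × A → ZMod 3, phaseGram θ
      = (Fintype.card (Fin m × A → ZMod 3) : ℂ) • (1 : Matrix A A ℂ) := by
  have hm' : (m : ℂ) ≠ 0 := by exact_mod_cast hm
  ext a' a
  simp only [Matrix.sum_apply, phaseGram_apply, ← Finset.mul_sum, Matrix.smul_apply, one_apply]
  rw [Finset.sum_comm]
  have h : ∀ i : Fin m, ∑ θ : Fin m × A → ZMod 3, ZMod.stdAddChar (θ (i, a) - θ (i, a'))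
      = if a' = a then (Fintype.card (Fin m × A → ZMod 3) : ℂ) else 0 := by
    intro i
    -- Equal third and fourth indices reduce the fourth moment to a second moment.
    have := sum_phases (i, a) (i, a') (i, a) (i, a)
    simp only [add_sub_cancel_right] at this
    rw [this]
    refine if_congr ?_ rfl rfl
    simp [eq_comm]
  simp only [h, Finset.sum_const, Finset.card_univ, Fintype.card_fin, nsmul_eq_mul]
  split_ifs <;> simp [hm']

end RandomKraus

/-! ### Partial traces, pinching and the decoder's second moment -/

section Bipartite

variable {A B C : Type*} [Fintype A] [DecidableEq A] [Fintype B] [DecidableEq B] [Fintype C]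

/-- The partial trace over the first factor. -/
noncomputable def reduced {A B : Type*} [Fintype A] (X : Matrix (A × B) (A × B) ℂ) : Matrix B B ℂ :=
  of fun b b' => ∑ a, X (a, b) (a, b')

omit [DecidableEq A] [Fintype B] [DecidableEq B] in
lemma reduced_apply (X : Matrix (A × B) (A × B) ℂ) (b b' : B) :
    reduced X b b' = ∑ a, X (a, b) (a, b') := rfl

omit [DecidableEq A] [Fintype B] [DecidableEq B] in
lemma reduced_eq_sum_submatrix (X : Matrix (A × B) (A × B) ℂ) :
    reduced X = ∑ a, X.submatrix (fun b => (a, b)) (fun b => (a, b)) := by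
  ext b b'; simp [reduced_apply, Matrix.sum_apply]

omit [DecidableEq A] [Fintype B] [DecidableEq B] in
lemma reduced_posSemidef {X : Matrix (A × B) (A × B) ℂ} (hX : X.PosSemidef) :
    (reduced X).PosSemidef := by
  rw [reduced_eq_sum_submatrix]
  exact posSemidef_sum _ fun a _ => hX.submatrix _

omit [DecidableEq A] [DecidableEq B] in
lemma trace_reduced (X : Matrix (A × B) (A × B) ℂ) : (reduced X).trace = X.trace := by
  simp only [trace, diag_apply, reduced_apply, Fintype.sum_prod_type]
  exact Finset.sum_comm

omit [DecidableEq B] in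
lemma trace_mul_one_kronecker (X : Matrix (A × B) (A × B) ℂ) (Y : Matrix B B ℂ) :
    (X * ((1 : Matrix A A ℂ) ⊗ₖ Y)).trace = (reduced X * Y).trace := by
  simp only [trace, diag_apply, mul_apply, kroneckerMap_apply, reduced_apply,
    Fintype.sum_prod_type, one_apply, ite_mul, one_mul, zero_mul, mul_ite, mul_zero,
    Finset.sum_mul]
  rw [Finset.sum_comm]
  refine Finset.sum_congr rfl fun b _ => ?_
  rw [Finset.sum_comm]
  rw [Finset.sum_comm]
  refine (Finset.sum_congr rfl fun a _ => ?_).trans Finset.sum_comm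
  rw [Finset.sum_comm]
  simp

omit [DecidableEq A] in
lemma reduced_conj_apply (K : Matrix C A ℂ) (X : Matrix (A × B) (A × B) ℂ) (b b' : B) :
    reduced ((K ⊗ₖ (1 : Matrix B B ℂ)) * X * (K ⊗ₖ (1 : Matrix B B ℂ))ᴴ) b b'
      = ∑ a, ∑ a', (Kᴴ * K) a' a * X (a, b) (a', b') := by
  simp only [reduced_apply, mul_apply, conjTranspose_apply, kroneckerMap_apply,
    Fintype.sum_prod_type, one_apply, mul_ite, mul_one, mul_zero, ite_mul, zero_mul,
    apply_ite star, star_zero, Finset.sum_ite_eq, Finset.mem_univ, if_true, Finset.sum_mul]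
  rw [Finset.sum_comm]
  conv_rhs => rw [Finset.sum_comm]
  refine Finset.sum_congr rfl fun a' _ => ?_
  rw [Finset.sum_comm]
  refine Finset.sum_congr rfl fun a _ => ?_
  exact Finset.sum_congr rfl fun i _ => by ring

omit [DecidableEq A] [DecidableEq B] in
lemma trace_mul_kronecker (X : Matrix (A × B) (A × B) ℂ) (G : Matrix A A ℂ) (S : Matrix B B ℂ) :
    (X * (G ⊗ₖ S)).trace = ∑ b, ∑ b', ∑ a, ∑ a', X (a, b) (a', b') * (G a' a * S b' b) := by
  simp only [trace, diag_apply, mul_apply, kroneckerMap_apply, Fintype.sum_prod_type]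
  rw [Finset.sum_comm]
  refine Finset.sum_congr rfl fun b _ => ?_
  exact (Finset.sum_congr rfl fun a _ => Finset.sum_comm).trans Finset.sum_comm

/-- The part of `Tr[X Y]` that is block diagonal with respect to the first factor. -/
noncomputable def diagTrace {A B : Type*} [Fintype A] [Fintype B] (X Y : Matrix (A × B) (A × B) ℂ) : ℂ :=
  ∑ a, (X.submatrix (fun b => (a, b)) (fun b => (a, b)) *
    Y.submatrix (fun b => (a, b)) (fun b => (a, b))).trace

omit [DecidableEq A] in
lemma re_diagTrace_nonneg {X Y : Matrix (A × B) (A × B) ℂ} (hX : X.PosSemidef)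
    (hY : Y.PosSemidef) : 0 ≤ (diagTrace X Y).re := by
  rw [diagTrace, Complex.re_sum]
  exact Finset.sum_nonneg fun a _ => re_trace_mul_nonneg (hX.submatrix _) (hY.submatrix _)

omit [DecidableEq A] in
-- The right side is a sum over all pairs of diagonal blocks, each term nonnegative; the left side
-- keeps only equal pairs.
lemma re_diagTrace_le {X Y : Matrix (A × B) (A × B) ℂ} (hX : X.PosSemidef)
    (hY : Y.PosSemidef) : (diagTrace X Y).re ≤ (reduced X * reduced Y).trace.re := by
  have h : (reduced X * reduced Y).trace.re = ∑ a, ∑ c,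
      (X.submatrix (fun b => (a, b)) (fun b => (a, b)) *
        Y.submatrix (fun b => (c, b)) (fun b => (c, b))).trace.re := by
    rw [reduced_eq_sum_submatrix, reduced_eq_sum_submatrix, Finset.sum_mul_sum, trace_sum,
      Complex.re_sum]
    exact Finset.sum_congr rfl fun a _ => by rw [trace_sum, Complex.re_sum]
  rw [h, diagTrace, Complex.re_sum]
  exact Finset.sum_le_sum fun a _ => Finset.single_le_sum (f := fun c =>
    (X.submatrix (fun b => (a, b)) (fun b => (a, b)) *
        Y.submatrix (fun b => (c, b)) (fun b => (c, b))).trace.re)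
    (fun c _ => re_trace_mul_nonneg (hX.submatrix _) (hY.submatrix _)) (Finset.mem_univ a)

/-- Pinching onto the diagonal blocks loses at most the number of blocks. -/
lemma re_trace_mul_le_card_mul_diagTrace {X Y : Matrix (A × B) (A × B) ℂ} (hX : X.PosSemidef)
    (hY : Y.PosSemidef) :
    (X * Y).trace.re ≤ Fintype.card A * (diagTrace X Y).re := by
  obtain ⟨R, rfl⟩ := exists_conjTranspose_mul_self hX
  obtain ⟨Q, rfl⟩ := exists_conjTranspose_mul_self hY
  set Z : A → Matrix (A × B) (A × B) ℂ := fun a =>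
    R.submatrix id (fun b => (a, b)) * (Q.submatrix id (fun b => (a, b)))ᴴ with hZ
  -- Both traces become Hilbert-Schmidt norms: of `∑ Z a` on the left, of the separate `Z a` on the
  -- right. Cauchy-Schwarz over the `d_A` summands compares them.
  have h1 : R * Qᴴ = ∑ a, Z a := by
    ext i j
    simp [hZ, mul_apply, Matrix.sum_apply, Fintype.sum_prod_type]
  have h2 : (Rᴴ * R * (Qᴴ * Q)).trace = ((R * Qᴴ)ᴴ * (R * Qᴴ)).trace := by
    rw [conjTranspose_mul, conjTranspose_conjTranspose, trace_mul_comm, Matrix.mul_assoc Qᴴ,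
      trace_mul_comm]
    simp only [Matrix.mul_assoc]
  have h3 : (diagTrace (Rᴴ * R) (Qᴴ * Q)).re = ∑ a, ((Z a)ᴴ * Z a).trace.re := by
    rw [diagTrace, Complex.re_sum]
    refine Finset.sum_congr rfl fun a _ => ?_
    have e : ∀ P : Matrix (A × B) (A × B) ℂ,
        (Pᴴ * P).submatrix (fun b => (a, b)) (fun b => (a, b))
        = (P.submatrix id (fun b => (a, b)))ᴴ * P.submatrix id (fun b => (a, b)) := by
      intro P; ext b b'; simp [mul_apply]
    rw [e, e, hZ]
    simp only [conjTranspose_mul, conjTranspose_conjTranspose]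
    rw [Matrix.mul_assoc, trace_mul_comm, Matrix.mul_assoc, trace_mul_comm]
    simp only [Matrix.mul_assoc]
    rw [trace_mul_comm]
    simp only [Matrix.mul_assoc]
  rw [h2, h3, h1]
  simp only [re_trace_conjTranspose_mul_self, Matrix.sum_apply]
  calc ∑ i, ∑ j, ‖∑ a, Z a i j‖ ^ 2
      ≤ ∑ i, ∑ j, Fintype.card A * ∑ a, ‖Z a i j‖ ^ 2 := by
        refine Finset.sum_le_sum fun i _ => Finset.sum_le_sum fun j _ => ?_
        refine (pow_le_pow_left₀ (norm_nonneg _) (norm_sum_le _ _) 2).trans ?_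
        exact sq_sum_le_card_mul_sum_sq
    _ = Fintype.card A * ∑ a, ∑ i, ∑ j, ‖Z a i j‖ ^ 2 := by
        simp only [Finset.mul_sum]
        exact (Finset.sum_congr rfl fun i _ => Finset.sum_comm).trans Finset.sum_comm

variable {m : ℕ}

/-- The second moment that governs the decoder. -/
lemma sum_trace_mul_phaseGram_kronecker (hm : m ≠ 0) (X Y : Matrix (A × B) (A × B) ℂ) :
    ∑ θ : Fin m × A → ZMod 3, (X * (phaseGram θ ⊗ₖ reduced
        ((phaseMatrix θ ⊗ₖ (1 : Matrix B B ℂ)) * Y *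
          (phaseMatrix θ ⊗ₖ (1 : Matrix B B ℂ))ᴴ))).trace
      = (Fintype.card (Fin m × A → ZMod 3) : ℂ) * ((reduced X * reduced Y).trace
        + (m : ℂ)⁻¹ * ((X * Y).trace - diagTrace X Y)) := by
  have h1 : ∀ θ : Fin m × A → ZMod 3, (X * (phaseGram θ ⊗ₖ reduced
        ((phaseMatrix θ ⊗ₖ (1 : Matrix B B ℂ)) * Y *
          (phaseMatrix θ ⊗ₖ (1 : Matrix B B ℂ))ᴴ))).trace
      = ∑ b, ∑ b', ∑ a, ∑ a', ∑ c, ∑ c', X (a, b) (a', b') * Y (c, b') (c', b) *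
        (phaseGram θ a' a * phaseGram θ c' c) := by
    intro θ
    rw [trace_mul_kronecker]
    refine Finset.sum_congr rfl fun b _ => Finset.sum_congr rfl fun b' _ =>
      Finset.sum_congr rfl fun a _ => Finset.sum_congr rfl fun a' _ => ?_
    rw [reduced_conj_apply, Finset.mul_sum, Finset.mul_sum]
    refine Finset.sum_congr rfl fun c _ => ?_
    rw [Finset.mul_sum, Finset.mul_sum]
    refine Finset.sum_congr rfl fun c' _ => ?_
    rw [← phaseGram]; ring
  have h2 : ∑ θ : Fin m × A → ZMod 3, ∑ b, ∑ b', ∑ a, ∑ a', ∑ c, ∑ c',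
        X (a, b) (a', b') * Y (c, b') (c', b) * (phaseGram θ a' a * phaseGram θ c' c)
      = ∑ b, ∑ b', ∑ a, ∑ a', ∑ c, ∑ c', X (a, b) (a', b') * Y (c, b') (c', b) *
        ((Fintype.card (Fin m × A → ZMod 3) : ℂ) *
        ((if a = a' ∧ c = c' then 1 else 0) + (m : ℂ)⁻¹ * ((if a = c' ∧ a' = c then 1 else 0)
          - if a = c' ∧ a' = c ∧ a = a' then 1 else 0))) := by
    rw [Finset.sum_comm]; refine Finset.sum_congr rfl fun b _ => ?_
    rw [Finset.sum_comm]; refine Finset.sum_congr rfl fun b' _ => ?_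
    rw [Finset.sum_comm]; refine Finset.sum_congr rfl fun a _ => ?_
    rw [Finset.sum_comm]; refine Finset.sum_congr rfl fun a' _ => ?_
    rw [Finset.sum_comm]; refine Finset.sum_congr rfl fun c _ => ?_
    rw [Finset.sum_comm]; refine Finset.sum_congr rfl fun c' _ => ?_
    rw [← Finset.mul_sum, sum_phaseGram_mul hm]
  simp only [h1]
  rw [h2]
  generalize (Fintype.card (Fin m × A → ZMod 3) : ℂ) = N
  have e1 : (reduced X * reduced Y).trace
      = ∑ b, ∑ b', ∑ a, ∑ c, X (a, b) (a, b') * Y (c, b') (c, b) := by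
    simp only [trace, diag_apply, mul_apply, reduced_apply, Finset.sum_mul_sum]
  have e2 : (X * Y).trace = ∑ b, ∑ b', ∑ a, ∑ a', X (a, b) (a', b') * Y (a', b') (a, b) := by
    simp only [trace, diag_apply, mul_apply, Fintype.sum_prod_type]
    rw [Finset.sum_comm]
    refine Finset.sum_congr rfl fun b _ => ?_
    exact (Finset.sum_congr rfl fun a _ => Finset.sum_comm).trans Finset.sum_comm
  have e3 : diagTrace X Y = ∑ b, ∑ b', ∑ a, X (a, b) (a, b') * Y (a, b') (a, b) := by
    simp only [diagTrace, trace, diag_apply, mul_apply, submatrix_apply]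
    rw [Finset.sum_comm]
    exact Finset.sum_congr rfl fun b _ => Finset.sum_comm
  rw [e1, e2, e3]
  simp only [Finset.mul_sum, ← Finset.sum_add_distrib, ← Finset.sum_sub_distrib]
  refine Finset.sum_congr rfl fun b _ => Finset.sum_congr rfl fun b' _ =>
    Finset.sum_congr rfl fun a _ => ?_
  have f1 : ∀ f : A → A → A → ℂ, (∑ a', ∑ c, ∑ c', if a = a' ∧ c = c' then f a' c c' else 0)
      = ∑ c, f a c c := by
    intro f
    simp [ite_and]
  have f2 : ∀ f : A → A → A → ℂ, (∑ a', ∑ c, ∑ c', if a = c' ∧ a' = c then f a' c c' else 0)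
      = ∑ a', f a' a' a := by
    intro f
    simp [ite_and]
  have f3 : ∀ f : A → A → A → ℂ,
      (∑ a', ∑ c, ∑ c', if a = c' ∧ a' = c ∧ a = a' then f a' c c' else 0) = f a a a := by
    intro f
    simp [ite_and]
  simp only [mul_add, mul_sub, mul_ite, mul_one, mul_zero, Finset.sum_add_distrib,
    Finset.sum_sub_distrib, f1, f2, f3]
  congr 1
  · rw [Finset.mul_sum]
    exact Finset.sum_congr rfl fun c _ => by ring
  · congr 1
    · rw [Finset.mul_sum, Finset.mul_sum]
      exact Finset.sum_congr rfl fun c _ => by ring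
    · ring

end Bipartite

/-! ### The pretty good decoder -/

section Decoder

variable {A B : Type*} [Fintype A] [DecidableEq A] [Fintype B] [DecidableEq B] {m : ℕ}

/-- The canonical maximally entangled vector. -/
noncomputable def maxEntVec (m : ℕ) : Fin m × Fin m → ℂ :=
  fun p => if p.1 = p.2 then (((√(m : ℝ))⁻¹ : ℝ) : ℂ) else 0

lemma star_maxEntVec (m : ℕ) : star (maxEntVec m) = maxEntVec m := by
  ext p
  simp only [Pi.star_apply, maxEntVec, apply_ite star, star_zero, Complex.star_def,
    Complex.conj_ofReal]

lemma trace_maxEnt (hm : m ≠ 0) :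
    (vecMulVec (maxEntVec m) (star (maxEntVec m))).trace = 1 := by
  have hm' : (m : ℂ) ≠ 0 := by exact_mod_cast hm
  rw [star_maxEntVec, trace_vecMulVec]
  simp only [dotProduct, maxEntVec, Fintype.sum_prod_type, mul_ite, mul_zero, ite_mul, zero_mul,
    Finset.sum_ite_eq, Finset.mem_univ, if_true, inv_sqrt_mul_self, Finset.sum_const,
    Finset.card_univ, Fintype.card_fin, nsmul_eq_mul]
  exact mul_inv_cancel₀ hm'

lemma isMaxEntangled_maxEnt (hm : m ≠ 0) :
    IsMaxEntangled m (vecMulVec (maxEntVec m) (star (maxEntVec m))) := by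
  refine ⟨Nat.one_le_iff_ne_zero.mpr hm, le_rfl, EuclideanSpace.basisFun _ _,
    EuclideanSpace.basisFun _ _, maxEntVec m, fun p => ?_, rfl⟩
  obtain ⟨p, q⟩ := p
  simp [maxEntVec]

/-- The unnormalized pretty good decoder: the Kraus operators of the map that undoes the
conjugate of `K` on the range of `P`, followed by `T`. -/
noncomputable def decoder (K : Matrix (Fin m) A ℂ) (P : Matrix (A × B) (A × B) ℂ)
    (T : Matrix B B ℂ) (k : A × B) : Matrix (Fin m) B ℂ :=
  (of fun i b => star (((K ⊗ₖ (1 : Matrix B B ℂ)) * P) (i, b) k)) * T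

omit [DecidableEq A] in
-- This is why `T` should be an inverse square root of the reduced operator: then the Kraus
-- operators sum to at most the identity.
lemma sum_decoder (K : Matrix (Fin m) A ℂ) {P : Matrix (A × B) (A × B) ℂ} (hP : P.IsHermitian)
    (hPP : P * P = P) {T : Matrix B B ℂ} (hT : T.IsHermitian) :
    ∑ k, (decoder K P T k)ᴴ * decoder K P T k
      = T * reduced ((K ⊗ₖ (1 : Matrix B B ℂ)) * P * (K ⊗ₖ (1 : Matrix B B ℂ))ᴴ) * T := by
  set Q := (K ⊗ₖ (1 : Matrix B B ℂ)) * P with hQ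
  have h1 : Q * (K ⊗ₖ (1 : Matrix B B ℂ))ᴴ = Q * Qᴴ := by
    rw [hQ, conjTranspose_mul, hP.eq]
    simp only [← Matrix.mul_assoc]
    rw [Matrix.mul_assoc _ P P, hPP]
  have h2 : ∑ k, (of fun i b => star (Q (i, b) k))ᴴ * (of fun i b => star (Q (i, b) k))
      = reduced (Q * Qᴴ) := by
    ext b b'
    simp only [Matrix.sum_apply, mul_apply, conjTranspose_apply, of_apply, star_star,
      reduced_apply]
    exact Finset.sum_comm
  rw [h1, ← h2, Finset.mul_sum, Finset.sum_mul]
  refine Finset.sum_congr rfl fun k _ => ?_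
  simp only [decoder, ← hQ, conjTranspose_mul, hT.eq, Matrix.mul_assoc]

omit [DecidableEq A] in
-- Contracting with the maximally entangled vector moves Bob's operator to Alice's side as a
-- transpose. The complex conjugation in `decoder` turns this into an adjoint, so `K†K` and a row of
-- `P` appear.
lemma maxEnt_vecMul_decoder (K : Matrix (Fin m) A ℂ) {P : Matrix (A × B) (A × B) ℂ}
    (hP : P.IsHermitian) (T : Matrix B B ℂ) (k : A × B) :
    star (maxEntVec m) ᵥ* (K ⊗ₖ decoder K P T k)
      = (((√(m : ℝ))⁻¹ : ℝ) : ℂ) • (P * ((Kᴴ * K) ⊗ₖ T)) k := by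
  ext ⟨a, b⟩
  rw [star_maxEntVec]
  have hP' : ∀ x, star (P x k) = P k x := fun x => hP.apply k x
  simp only [vecMul, dotProduct, maxEntVec, Fintype.sum_prod_type, kroneckerMap_apply,
    ite_mul, zero_mul, Finset.sum_ite_eq, Finset.mem_univ, if_true]
  simp only [decoder, mul_apply, of_apply, Fintype.sum_prod_type, kroneckerMap_apply,
    ite_mul, zero_mul, Finset.sum_ite_eq, Finset.mem_univ, if_true,
    Pi.smul_apply, smul_eq_mul, one_apply, mul_ite, mul_one, mul_zero, star_sum, star_mul',
    conjTranspose_apply, hP', Finset.mul_sum, Finset.sum_mul]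
  rw [Finset.sum_comm]
  conv_lhs => enter [2, b']; rw [Finset.sum_comm]
  rw [Finset.sum_comm]
  refine Finset.sum_congr rfl fun a' _ => Finset.sum_congr rfl fun b' _ =>
    Finset.sum_congr rfl fun i _ => by ring

omit [DecidableEq A] in
-- Each overlap is a diagonal entry of `P G X G P` with `G = K†K ⊗ T`, up to `1/m`; summing over `k`
-- gives a trace.
lemma sum_trace_decoder (K : Matrix (Fin m) A ℂ) {P : Matrix (A × B) (A × B) ℂ}
    (hP : P.IsHermitian) (hPP : P * P = P) {T : Matrix B B ℂ} (hT : T.IsHermitian)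
    (X : Matrix (A × B) (A × B) ℂ) :
    ∑ k, ((K ⊗ₖ decoder K P T k) * X * (K ⊗ₖ decoder K P T k)ᴴ *
        vecMulVec (maxEntVec m) (star (maxEntVec m))).trace
      = (m : ℂ)⁻¹ * (X * (((Kᴴ * K) ⊗ₖ T) * P * ((Kᴴ * K) ⊗ₖ T))).trace := by
  set G := (Kᴴ * K) ⊗ₖ T with hG
  have hGh : Gᴴ = G := by
    rw [hG, conjTranspose_kronecker, hT.eq, conjTranspose_mul, conjTranspose_conjTranspose]
  have h1 : ∀ k, ((K ⊗ₖ decoder K P T k) * X * (K ⊗ₖ decoder K P T k)ᴴ *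
        vecMulVec (maxEntVec m) (star (maxEntVec m))).trace
      = (m : ℂ)⁻¹ * ((P * G) * X * (P * G)ᴴ) k k := by
    intro k
    have h2 := maxEnt_vecMul_decoder K hP T k
    have h3 : (K ⊗ₖ decoder K P T k)ᴴ *ᵥ maxEntVec m
        = star (star (maxEntVec m) ᵥ* (K ⊗ₖ decoder K P T k)) := by
      rw [star_vecMul, star_star]
    rw [trace_mul_comm, vecMulVec_mul, trace_vecMulVec, dotProduct_comm, ← Matrix.vecMul_vecMul,
      ← Matrix.vecMul_vecMul, ← dotProduct_mulVec, h3, h2, Matrix.smul_vecMul, star_smul,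
      smul_dotProduct, dotProduct_smul, smul_smul, Complex.star_def, Complex.conj_ofReal,
      inv_sqrt_mul_self, smul_eq_mul]
    rfl
  simp only [h1, ← Finset.mul_sum]
  congr 1
  change ((P * G) * X * (P * G)ᴴ).trace = _
  rw [conjTranspose_mul, hGh, hP.eq, trace_mul_comm, ← Matrix.mul_assoc, Matrix.mul_assoc G P,
    ← Matrix.mul_assoc P P, hPP, trace_mul_comm]
  simp only [Matrix.mul_assoc]

end Decoder

/-! ### Average performance of the random protocol -/

section Protocol

variable {A B : Type*} [Fintype A] [DecidableEq A] [Fintype B] [DecidableEq B] {m : ℕ}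

/-- Expand `Tr[ρ (X - α) P (X - α)] ≥ 0`, with `P` absorbed by `ρ`. This replaces the quadratic
dependence on `X` by a linear one. -/
lemma sub_le_re_trace_mul_conj {n : Type*} [Fintype n] [DecidableEq n] {ρ P X : Matrix n n ℂ}
    (hρ : ρ.PosSemidef) (hP : P.PosSemidef) (h₁ : P * ρ = ρ) (h₂ : ρ * P = ρ)
    (hX : X.IsHermitian) (α : ℝ) :
    2 * α * (ρ * X).trace.re - α ^ 2 * ρ.trace.re ≤ (ρ * (X * P * X)).trace.re := by
  have hY : (X - (α : ℂ) • 1)ᴴ = X - (α : ℂ) • 1 := by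
    rw [conjTranspose_sub, hX.eq, conjTranspose_smul, conjTranspose_one, Complex.star_def,
      Complex.conj_ofReal]
  have h := hP.mul_mul_conjTranspose_same (X - (α : ℂ) • 1)
  rw [hY] at h
  have h0 := re_trace_mul_nonneg hρ h
  have e : (ρ * ((X - (α : ℂ) • 1) * P * (X - (α : ℂ) • 1))).trace
      = (ρ * (X * P * X)).trace - (α : ℂ) * (ρ * X).trace - (α : ℂ) * (ρ * X).trace
        + ((α ^ 2 : ℝ) : ℂ) * ρ.trace := by
    have e1 : ρ * ((X - (α : ℂ) • 1) * P * (X - (α : ℂ) • 1))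
        = ρ * (X * P * X) - (α : ℂ) • (ρ * X * P) - (α : ℂ) • (ρ * P * X)
          + ((α ^ 2 : ℝ) : ℂ) • (ρ * P) := by
      simp only [Matrix.sub_mul, Matrix.mul_sub, Matrix.smul_mul, Matrix.mul_smul, Matrix.one_mul,
        Matrix.mul_one, smul_sub, smul_smul, Matrix.mul_assoc]
      push_cast
      rw [pow_two]
      abel
    rw [e1, trace_add, trace_sub, trace_sub, trace_smul, trace_smul, trace_smul, h₂,
      trace_mul_comm (ρ * X) P, ← Matrix.mul_assoc P, h₁]
    simp only [smul_eq_mul]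
  rw [e] at h0
  simp only [Complex.add_re, Complex.sub_re, Complex.re_ofReal_mul] at h0
  linarith

/-- Bob's operator `T` for a fixed matrix `K` of Alice. -/
lemma exists_decoder_bound (hm : m ≠ 0) (K : Matrix (Fin m) A ℂ)
    {ρ P : Matrix (A × B) (A × B) ℂ}
    (hρ : ρ.PosSemidef) (hP : P.PosSemidef) (h₁ : P * ρ = ρ) (h₂ : ρ * P = ρ) :
    ∃ T : Matrix B B ℂ, T.IsHermitian ∧
      T * reduced ((K ⊗ₖ (1 : Matrix B B ℂ)) * P * (K ⊗ₖ (1 : Matrix B B ℂ))ᴴ) * T ≤ 1 ∧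
      3 * (ρ * ((Kᴴ * K) ⊗ₖ (1 : Matrix B B ℂ))).trace.re
          - m * (ρ * ((Kᴴ * K) ⊗ₖ reduced
              ((K ⊗ₖ (1 : Matrix B B ℂ)) * P * (K ⊗ₖ (1 : Matrix B B ℂ))ᴴ))).trace.re
          - ρ.trace.re
        ≤ (m : ℝ)⁻¹ * (ρ * (((Kᴴ * K) ⊗ₖ T) * P * ((Kᴴ * K) ⊗ₖ T))).trace.re := by
  set S := reduced ((K ⊗ₖ (1 : Matrix B B ℂ)) * P * (K ⊗ₖ (1 : Matrix B B ℂ))ᴴ)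
  have hS : S.PosSemidef := reduced_posSemidef (hP.mul_mul_conjTranspose_same _)
  have hG : (Kᴴ * K).PosSemidef := posSemidef_conjTranspose_mul_self K
  set G := Kᴴ * K
  have hmR : (0 : ℝ) < m := by exact_mod_cast Nat.pos_of_ne_zero hm
  -- This places the tangent point `α⁻²` at `1/m` and also serves as the shift in the quadratic
  -- bound.
  set α := √(m : ℝ)
  have hα : 0 < α := Real.sqrt_pos.mpr hmR
  have hαα : α ^ 2 = m := Real.sq_sqrt hmR.le
  obtain ⟨T, hT, -, hTST, htan⟩ := exists_invSqrt hS hα.le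
  refine ⟨T, hT.isHermitian, hTST, ?_⟩
  have hGT : (G ⊗ₖ T).IsHermitian := (hG.kronecker hT).isHermitian
  have hq := sub_le_re_trace_mul_conj hρ hP h₁ h₂ hGT α
  have hle : (3 / 2 * α) • (G ⊗ₖ (1 : Matrix B B ℂ)) - (α ^ 3 / 2) • (G ⊗ₖ S) ≤ G ⊗ₖ T := by
    rw [le_iff] at htan ⊢
    have := hG.kronecker htan
    have e : G ⊗ₖ (T - ((3 / 2 * α) • (1 : Matrix B B ℂ) - (α ^ 3 / 2) • S))
        = G ⊗ₖ T - ((3 / 2 * α) • (G ⊗ₖ (1 : Matrix B B ℂ)) - (α ^ 3 / 2) • (G ⊗ₖ S)) := by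
      ext ⟨a, b⟩ ⟨a', b'⟩
      simp only [kroneckerMap_apply, Matrix.sub_apply, Matrix.smul_apply, Complex.real_smul]
      ring
    rwa [e] at this
  have hlin := re_trace_mul_mono hρ hle
  rw [Matrix.mul_sub, Matrix.mul_smul, Matrix.mul_smul, trace_sub, trace_smul, trace_smul,
    Complex.sub_re, Complex.real_smul, Complex.real_smul, Complex.re_ofReal_mul,
    Complex.re_ofReal_mul] at hlin
  generalize (ρ * (G ⊗ₖ (1 : Matrix B B ℂ))).trace.re = x at *
  generalize (ρ * (G ⊗ₖ S)).trace.re = y at *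
  generalize (ρ * (G ⊗ₖ T)).trace.re = z at *
  generalize (ρ * ((G ⊗ₖ T) * P * (G ⊗ₖ T))).trace.re = q at *
  generalize ρ.trace.re = t at *
  rw [← div_eq_inv_mul, le_div_iff₀ hmR, ← hαα]
  have h3 := mul_le_mul_of_nonneg_left hlin (by positivity : 0 ≤ 2 * α)
  nlinarith

/-- Existence of a good one-way protocol for the maximally entangled target of rank `m`. -/
theorem exists_protocol (hm : m ≠ 0) {ρ : Matrix (A × B) (A × B) ℂ} (hρ : ρ.PosSemidef) {lam : ℝ}
    (hlam : (reduced ρ * reduced (suppProj ρ)).trace.re ≤ lam * ρ.trace.re) :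
    ∃ M : (Fin m × A → ZMod 3) × ((A × B) ⊕ B) → Matrix (Fin m × Fin m) (A × B) ℂ,
      ∑ p, (M p)ᴴ * M p = 1 ∧ IsOneWayLOCC (krausMap M) ∧
      ρ.trace.re * (1 - m * lam)
        ≤ (krausMap M ρ * vecMulVec (maxEntVec m) (star (maxEntVec m))).trace.re := by
  have hmR : (0 : ℝ) < m := by exact_mod_cast Nat.pos_of_ne_zero hm
  set P := suppProj ρ
  have hP : P.PosSemidef := suppProj_posSemidef ρ
  have hPP : P * P = P := suppProj_mul_suppProj ρ
  have h₁ : P * ρ = ρ := suppProj_mul_self ρ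
  have h₂ : ρ * P = ρ := mul_suppProj_self ρ hρ.isHermitian
  choose T hT hTST hbound using fun θ : Fin m × A → ZMod 3 =>
    exists_decoder_bound hm (phaseMatrix θ) hρ hP h₁ h₂
  set N : ℝ := (Fintype.card (Fin m × A → ZMod 3) : ℝ) with hN
  have hN0 : 0 < N := by rw [hN]; exact_mod_cast Fintype.card_pos
  have hNC : ((Fintype.card (Fin m × A → ZMod 3) : ℕ) : ℂ) = (N : ℂ) := by rw [hN]; norm_cast
  set c : ℂ := Complex.ofReal (√N)⁻¹ with hc
  have hcc : star c * c = ((N⁻¹ : ℝ) : ℂ) := by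
    rw [hc, Complex.star_def, Complex.conj_ofReal, ← Complex.ofReal_mul, ← mul_inv,
      Real.mul_self_sqrt hN0.le]
  set K : (Fin m × A → ZMod 3) → Matrix (Fin m) A ℂ := fun θ => c • phaseMatrix θ with hK
  set i₀ : Fin m := ⟨0, Nat.pos_of_ne_zero hm⟩
  -- `R` is the square root of the decoder's defect. Sending that part to a fixed basis vector makes
  -- Bob's map trace preserving and can only add to the overlap.
  set R : (Fin m × A → ZMod 3) → Matrix B B ℂ := fun θ => CFC.sqrt (1 - T θ * reduced
    ((phaseMatrix θ ⊗ₖ (1 : Matrix B B ℂ)) * P * (phaseMatrix θ ⊗ₖ (1 : Matrix B B ℂ))ᴴ) * T θ)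
  set L : (Fin m × A → ZMod 3) → (A × B) ⊕ B → Matrix (Fin m) B ℂ := fun θ =>
    Sum.elim (decoder (phaseMatrix θ) P (T θ)) (fun b => single i₀ b (1 : ℂ) * R θ) with hL
  have hKsum : ∑ θ, (K θ)ᴴ * K θ = 1 := by
    have : ∀ θ, (K θ)ᴴ * K θ = ((N⁻¹ : ℝ) : ℂ) • phaseGram θ := by
      intro θ
      simp only [hK, conjTranspose_smul, Matrix.smul_mul, Matrix.mul_smul, smul_smul, phaseGram]
      rw [mul_comm c, hcc]
    simp only [this, ← Finset.smul_sum, sum_phaseGram hm, smul_smul, hNC]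
    rw [← Complex.ofReal_mul, inv_mul_cancel₀ hN0.ne', Complex.ofReal_one, one_smul]
  have hLsum : ∀ θ, ∑ k, (L θ k)ᴴ * L θ k = 1 := by
    intro θ
    have hRh : (R θ)ᴴ = R θ := (sqrt_isHermitian _).eq
    have hR : ∑ b : B, (single i₀ b (1 : ℂ) * R θ)ᴴ * (single i₀ b (1 : ℂ) * R θ)
        = R θ * R θ := by
      have h : ∀ b : B, (single i₀ b (1 : ℂ) * R θ)ᴴ * (single i₀ b (1 : ℂ) * R θ)
          = R θ * ((single i₀ b (1 : ℂ))ᴴ * single i₀ b (1 : ℂ)) * R θ := by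
        intro b
        rw [conjTranspose_mul, hRh]
        simp only [Matrix.mul_assoc]
      simp only [h, ← Finset.sum_mul, ← Finset.mul_sum]
      rw [sum_single_diag, Matrix.mul_one]
    rw [Fintype.sum_sum_type]
    simp only [hL, Sum.elim_inl, Sum.elim_inr]
    rw [sum_decoder _ hP.isHermitian hPP (hT θ), hR,
      CFC.sqrt_mul_sqrt_self _ (sub_nonneg.mpr (hTST θ))]
    abel
  refine ⟨fun p => K p.1 ⊗ₖ L p.1 p.2, sum_kronecker_conjTranspose_mul_self hKsum hLsum,
    isOneWayLOCC_krausMap hKsum hLsum, ?_⟩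
  · set Ψ := vecMulVec (maxEntVec m) (star (maxEntVec m))
    have hΨ : Ψ.PosSemidef := posSemidef_vecMulVec_self_star _
    have hterm : ∀ θ, N⁻¹ * ((m : ℝ)⁻¹ * (ρ * ((phaseGram θ ⊗ₖ T θ) * P *
          (phaseGram θ ⊗ₖ T θ))).trace.re)
        ≤ ∑ k, ((K θ ⊗ₖ L θ k) * ρ * (K θ ⊗ₖ L θ k)ᴴ * Ψ).trace.re := by
      intro θ
      rw [Fintype.sum_sum_type]
      have h0 : 0 ≤ ∑ b, ((K θ ⊗ₖ L θ (Sum.inr b)) * ρ * (K θ ⊗ₖ L θ (Sum.inr b))ᴴ * Ψ).trace.re :=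
        Finset.sum_nonneg fun b _ => re_trace_mul_nonneg (hρ.mul_mul_conjTranspose_same _) hΨ
      refine le_trans (le_of_eq ?_) (le_add_of_nonneg_right h0)
      have h1 := congrArg Complex.re
        (sum_trace_decoder (phaseMatrix θ) hP.isHermitian hPP (hT θ) ρ)
      have h2 : ((m : ℂ)⁻¹) = (((m : ℝ)⁻¹ : ℝ) : ℂ) := by push_cast; rfl
      rw [h2, Complex.re_ofReal_mul, Complex.re_sum] at h1
      rw [phaseGram, ← h1, Finset.mul_sum]
      refine Finset.sum_congr rfl fun k _ => ?_
      simp only [hL, hK, Sum.elim_inl, smul_kronecker, conjTranspose_smul, Matrix.smul_mul,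
        Matrix.mul_smul, smul_smul, trace_smul]
      rw [hcc, smul_eq_mul, Complex.re_ofReal_mul]
    have hsum : (krausMap (fun p : (Fin m × A → ZMod 3) × ((A × B) ⊕ B) => K p.1 ⊗ₖ L p.1 p.2) ρ
          * Ψ).trace.re
        = ∑ θ, ∑ k, ((K θ ⊗ₖ L θ k) * ρ * (K θ ⊗ₖ L θ k)ᴴ * Ψ).trace.re := by
      rw [krausMap_apply, Finset.sum_mul, trace_sum, Complex.re_sum, Fintype.sum_prod_type]
    rw [hsum]
    refine le_trans ?_ (Finset.sum_le_sum fun θ _ => hterm θ)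
    rw [← Finset.mul_sum]
    refine le_trans ?_ (mul_le_mul_of_nonneg_left
      (Finset.sum_le_sum fun θ _ => hbound θ) (inv_nonneg.mpr hN0.le))
    have s1 : ∑ θ : Fin m × A → ZMod 3,
        (ρ * (((phaseMatrix θ)ᴴ * phaseMatrix θ) ⊗ₖ (1 : Matrix B B ℂ))).trace.re
        = N * ρ.trace.re := by
      rw [← Complex.re_sum, ← trace_sum, ← Finset.mul_sum]
      have h : ∑ θ : Fin m × A → ZMod 3,
          ((phaseMatrix θ)ᴴ * phaseMatrix θ) ⊗ₖ (1 : Matrix B B ℂ)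
          = (∑ θ : Fin m × A → ZMod 3, phaseGram θ) ⊗ₖ (1 : Matrix B B ℂ) := by
        ext i j
        simp only [Matrix.sum_apply, kroneckerMap_apply, Finset.sum_mul, phaseGram]
      rw [h, sum_phaseGram hm, smul_kronecker, one_kronecker_one, Matrix.mul_smul, Matrix.mul_one,
        trace_smul, smul_eq_mul, hNC, Complex.re_ofReal_mul]
    have s2 := congrArg Complex.re (sum_trace_mul_phaseGram_kronecker hm ρ P)
    have h2 : ((m : ℂ)⁻¹) = (((m : ℝ)⁻¹ : ℝ) : ℂ) := by push_cast; rfl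
    rw [h2, hNC, h₂, Complex.re_sum, Complex.re_ofReal_mul, Complex.add_re, Complex.re_ofReal_mul,
      Complex.sub_re] at s2
    simp only [phaseGram] at s2
    have hd := re_diagTrace_nonneg hρ hP
    simp only [Finset.sum_sub_distrib, ← Finset.mul_sum, s1, s2, Finset.sum_const,
      Finset.card_univ, nsmul_eq_mul, ← hN]
    generalize (diagTrace ρ P).re = d at hd ⊢
    generalize (reduced ρ * reduced P).trace.re = y at hlam ⊢
    generalize ρ.trace.re = t at hlam ⊢
    -- Of `3t`, one `t` is lost to the quadratic bound and one to the `1/m` part of the second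
    -- moment. The block-diagonal correction `d` has a favourable sign and is dropped.
    have e : N⁻¹ * (3 * (N * t) - m * (N * (y + (m : ℝ)⁻¹ * (t - d))) - N * t)
        = t - m * y + d := by
      field_simp
      ring
    rw [e]
    nlinarith

end Protocol

/-! ### From the protocol to achievable rates -/

section Achievability

variable {A B : Type*} [Fintype A] [DecidableEq A] [Fintype B] [DecidableEq B]

lemma re_trace_pos_of_mem_ball {ρ σ : Matrix (A × B) (A × B) ℂ} {δ : ℝ} (hδ : δ ^ 2 < 1)
    (hσ : σ ∈ ball ρ δ) : 0 < σ.trace.re := by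
  obtain ⟨hσ, -, hF⟩ := hσ
  refine lt_of_le_of_ne (re_trace_nonneg hσ) fun h => ?_
  have h0 : σ = 0 := hσ.trace_eq_zero_iff.mp
    (Complex.ext h.symm (Complex.nonneg_iff.mp hσ.trace_nonneg).2.symm)
  have : fidelity ρ σ = 0 := by simp [fidelity, h0]
  rw [this] at hF
  nlinarith

/-- The witness is the normalized marginal of `ρ` itself. The last bound is pinching applied to `Tr
ρ = Tr[ρ P]`. -/
lemma exists_state_reduced {ρ : Matrix (A × B) (A × B) ℂ} (hρ : ρ.PosSemidef)
    (ht : 0 < ρ.trace.re) :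
    ∃ σ : Matrix B B ℂ, IsState σ ∧
      (reduced ρ * reduced (suppProj ρ)).trace.re
        = (suppProj ρ * ((1 : Matrix A A ℂ) ⊗ₖ σ)).trace.re * ρ.trace.re ∧
      1 ≤ Fintype.card A * (suppProj ρ * ((1 : Matrix A A ℂ) ⊗ₖ σ)).trace.re := by
  have hP := suppProj_posSemidef ρ
  have hr := reduced_posSemidef hρ
  set t := ρ.trace.re
  have htr : ρ.trace = (t : ℂ) :=
    Complex.ext rfl (by rw [← (Complex.nonneg_iff.mp hρ.trace_nonneg).2]; simp)
  have key : (reduced ρ * reduced (suppProj ρ)).trace.re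
        = (suppProj ρ * ((1 : Matrix A A ℂ) ⊗ₖ (t⁻¹ • reduced ρ))).trace.re * t := by
    rw [trace_mul_one_kronecker, Matrix.mul_smul, trace_smul, Complex.real_smul,
      Complex.re_ofReal_mul, trace_mul_comm]
    field_simp
  refine ⟨t⁻¹ • reduced ρ, ⟨hr.smul (by positivity), ?_⟩, key, ?_⟩
  · rw [trace_smul, trace_reduced, htr, Complex.real_smul, ← Complex.ofReal_mul,
      inv_mul_cancel₀ ht.ne', Complex.ofReal_one]
  · have h1 := re_trace_mul_le_card_mul_diagTrace hρ hP
    rw [mul_suppProj_self ρ hρ.isHermitian] at h1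
    have h2 := mul_le_mul_of_nonneg_left (re_diagTrace_le hρ hP)
      (Nat.cast_nonneg (α := ℝ) (Fintype.card A))
    rw [key] at h2
    refine le_of_mul_le_mul_right (a := t) ?_ ht
    linarith

lemma isAchievableRate_logb {ρ ρ' : Matrix (A × B) (A × B) ℂ} (hρ : IsState ρ) {ε : ℝ}
    (hε : 0 ≤ ε) (hε1 : ε < 1) (hρ' : ρ' ∈ ball ρ (ε / 8)) {lam : ℝ}
    (hlam : ∀ σ : Matrix B B ℂ, IsState σ →
      (suppProj ρ' * ((1 : Matrix A A ℂ) ⊗ₖ σ)).trace.re ≤ lam)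
    {m : ℕ} (hm : 2 ≤ m)
    (hmlam : m * lam ≤ 5 / 4 * (1 / (Fintype.card A : ℝ) + ε ^ 2 / 4)) :
    IsAchievableRate ρ ε (Real.logb 2 m) := by
  have hm0 : m ≠ 0 := by omega
  have hmR : (2 : ℝ) ≤ m := by exact_mod_cast hm
  have ht := re_trace_pos_of_mem_ball (by nlinarith) hρ'
  obtain ⟨hpsd, ht1, hF⟩ := hρ'
  obtain ⟨σ, hσ, hred, hcard⟩ := exists_state_reduced hpsd ht
  have hσlam := hlam σ hσ
  set x := (suppProj ρ' * ((1 : Matrix A A ℂ) ⊗ₖ σ)).trace.re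
  have hd : (0 : ℝ) < Fintype.card A := by
    rcases (Nat.cast_nonneg (α := ℝ) (Fintype.card A)).eq_or_lt with h | h
    · rw [← h] at hcard; linarith
    · exact h
  have hinv : 1 / (Fintype.card A : ℝ) ≤ lam := by
    rw [div_le_iff₀ hd]
    nlinarith
  have hlam0 : 0 < lam := lt_of_lt_of_le (by positivity) hinv
  -- Since `1/d_A ≤ lam ≤ m lam / 2`, the hypothesis gives `(3/8) m lam ≤ (5/16) ε²`, so `m lam ≤
  -- (5/6) ε²`, and `5/6 < (63/64)²`.
  have hml : m * lam ≤ (63 / 64 * ε) ^ 2 := by nlinarith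
  obtain ⟨M, hM, hLOCC, hq⟩ := exists_protocol (m := m) hm0 hpsd (lam := lam)
    (by rw [hred]; exact mul_le_mul_of_nonneg_right hσlam ht.le)
  set Ψ := vecMulVec (maxEntVec m) (star (maxEntVec m)) with hΨdef
  have hΨ : Ψ.PosSemidef := posSemidef_vecMulVec_self_star _
  have hΨ1 : Ψ.trace = 1 := trace_maxEnt hm0
  have hΨΨ : Ψ * Ψ = Ψ := by
    have := vecMulVec_star_mul_self (maxEntVec m)
    rwa [← hΨdef, hΨ1, Complex.one_re, one_smul] at this
  have hΨ' : (1 - Ψ).PosSemidef := by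
    have := posSemidef_conjTranspose_mul_self (1 - Ψ)
    rw [conjTranspose_sub, conjTranspose_one, hΨ.isHermitian.eq] at this
    convert this using 1
    simp [Matrix.mul_sub, Matrix.sub_mul, hΨΨ]
  -- The test for `Ψ` pulled back through the protocol, now an effect on the input.
  set Ω := ∑ p, (M p)ᴴ * Ψ * M p with hΩdef
  have hΩ : Ω.PosSemidef := posSemidef_sum _ fun p _ => hΨ.conjTranspose_mul_mul_same (M p)
  have hΩ' : (1 - Ω).PosSemidef := by
    have : 1 - Ω = ∑ p, (M p)ᴴ * (1 - Ψ) * M p := by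
      rw [← hM, hΩdef, ← Finset.sum_sub_distrib]
      exact Finset.sum_congr rfl fun p _ => by
        rw [Matrix.mul_sub, Matrix.sub_mul, Matrix.mul_one]
    rw [this]
    exact posSemidef_sum _ fun p _ => hΨ'.conjTranspose_mul_mul_same (M p)
  have htrΩ : ∀ X, (krausMap M X * Ψ).trace = (X * Ω).trace := by
    intro X
    rw [krausMap_apply, hΩdef, Finset.sum_mul, Finset.mul_sum, trace_sum, trace_sum]
    refine Finset.sum_congr rfl fun p _ => ?_
    rw [Matrix.mul_assoc (M p), Matrix.mul_assoc (M p), trace_mul_comm (M p)]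
    simp only [Matrix.mul_assoc]
  have hmeas := fidelity_le_measurement hρ.1 hpsd hΩ hΩ'
  have hsub : ∀ X : Matrix (A × B) (A × B) ℂ,
      (X * (1 - Ω)).trace.re = X.trace.re - (X * Ω).trace.re := by
    intro X
    rw [Matrix.mul_sub, Matrix.mul_one, trace_sub, Complex.sub_re]
  have hp0 := re_trace_mul_nonneg hρ.1 hΩ
  have hq0 := re_trace_mul_nonneg hpsd hΩ'
  rw [htrΩ] at hq
  rw [hsub, hsub, hρ.2, Complex.one_re] at hmeas
  rw [hsub] at hq0
  have hfid := sqrt_re_trace_le_fidelity (posSemidef_krausMap M hρ.1) (maxEntVec m)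
  rw [← hΨdef, htrΩ] at hfid
  refine ⟨Real.logb_nonneg (by norm_num) (by linarith), m, m, Ψ, krausMap M, ?_,
    isMaxEntangled_maxEnt hm0, hLOCC, ?_⟩
  · rw [Real.rpow_logb (by norm_num) (by norm_num) (by linarith)]
  refine le_trans ?_ hfid
  generalize (ρ * Ω).trace.re = p at *
  generalize (ρ' * Ω).trace.re = q at *
  generalize ρ'.trace.re = t at *
  have hF0 := fidelity_nonneg ρ ρ'
  generalize fidelity ρ ρ' = F at *
  -- For `0 ≤ u ≤ 1` one has `u² ≤ u`, here with `u = 1 - (ε/8)²`.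
  have hF1 : 1 - (ε / 8) ^ 2 ≤ F := by
    by_contra hlt
    push Not at hlt
    have : F ^ 2 < 1 - (ε / 8) ^ 2 := by nlinarith
    linarith
  have s1 : √q ≤ 1 := Real.sqrt_le_one.mpr (by linarith)
  have s2 : √(1 - p) ≤ 1 := Real.sqrt_le_one.mpr (by linarith)
  have s3 : √(t - q) ≤ 63 / 64 * ε := by
    refine Real.sqrt_le_iff.mpr ⟨by linarith, ?_⟩
    nlinarith
  have s4 : √p * √q ≤ √p := mul_le_of_le_one_right (Real.sqrt_nonneg _) s1
  have s5 : √(1 - p) * √(t - q) ≤ √(t - q) := mul_le_of_le_one_left (Real.sqrt_nonneg _) s2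
  -- The losses are `ε²/64` from smoothing and `63ε/64` from decoding; as `ε < 1` they total at most
  -- `ε`.
  nlinarith

lemma isAchievableRate_zero {ρ : Matrix (A × B) (A × B) ℂ} (hρ : IsState ρ) {ε : ℝ}
    (hε : 0 ≤ ε) : IsAchievableRate ρ ε 0 := by
  obtain ⟨M, hM, hLOCC⟩ := exists_trivial_protocol A B one_ne_zero
  refine ⟨le_rfl, 1, 1, _, krausMap M, by simp, isMaxEntangled_maxEnt one_ne_zero, hLOCC, ?_⟩
  refine le_trans ?_ (sqrt_re_trace_le_fidelity (posSemidef_krausMap M hρ.1) (maxEntVec 1))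
  have h1 : vecMulVec (maxEntVec 1) (star (maxEntVec 1)) = 1 := by
    ext i j
    have hij : i = j := Subsingleton.elim _ _
    subst hij
    have := trace_maxEnt (m := 1) one_ne_zero
    rw [trace, Fintype.sum_subsingleton _ i] at this
    rw [one_apply_eq]
    exact this
  rw [h1, Matrix.mul_one, isTracePreserving_krausMap hM, hρ.2]
  simpa using hε

lemma isAchievableRate_of_one_le (ρ : Matrix (A × B) (A × B) ℂ) {ε : ℝ}
    (hε : 1 ≤ ε) {R : ℝ} (hR : 0 ≤ R) : IsAchievableRate ρ ε R := by
  obtain ⟨m, hm⟩ := exists_nat_ge ((2 : ℝ) ^ R)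
  have hm0 : m ≠ 0 := by
    rintro rfl
    have : (0 : ℝ) < 2 ^ R := by positivity
    simp at hm
    linarith
  obtain ⟨M, -, hLOCC⟩ := exists_trivial_protocol A B hm0
  exact ⟨hR, m, m, _, krausMap M, hm, isMaxEntangled_maxEnt hm0, hLOCC,
    le_trans (by linarith) (fidelity_nonneg _ _)⟩

lemma IsAchievableRate.le_oneWayDistillable {ρ : Matrix (A × B) (A × B) ℂ} {ε R : ℝ}
    (h : IsAchievableRate ρ ε R) : (R : EReal) ≤ oneWayDistillable ρ ε :=
  le_sSup ⟨R, h, rfl⟩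

lemma oneWayDistillable_of_one_le (ρ : Matrix (A × B) (A × B) ℂ) {ε : ℝ} (hε : 1 ≤ ε) :
    oneWayDistillable ρ ε = ⊤ := by
  rw [EReal.eq_top_iff_forall_lt]
  intro y
  refine lt_of_lt_of_le ?_
    (isAchievableRate_of_one_le ρ hε (by positivity : 0 ≤ |y| + 1)).le_oneWayDistillable
  exact_mod_cast (le_abs_self y).trans_lt (lt_add_one _)

/-- Testing each `ρ'` against its own normalized marginal bounds the quantity by `log d_A`. -/
lemma smoothZeroCoherentInfo_ne_top (ρ : Matrix (A × B) (A × B) ℂ) {δ : ℝ} (hδ : δ ^ 2 < 1) :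
    smoothZeroCoherentInfo ρ δ ≠ ⊤ := by
  refine ne_top_of_le_ne_top (EReal.coe_ne_top (Real.logb 2 (Fintype.card A)))
    (iSup₂_le fun ρ' hρ' => ?_)
  obtain ⟨σ, hσ, -, hcard⟩ := exists_state_reduced hρ'.1 (re_trace_pos_of_mem_ball hδ hρ')
  refine (iInf₂_le σ hσ).trans ?_
  unfold relRenyiZero
  generalize (suppProj ρ' * ((1 : Matrix A A ℂ) ⊗ₖ σ)).trace.re = x at *
  have hA : (0 : ℝ) ≤ Fintype.card A := Nat.cast_nonneg _
  have hx : 0 < x := by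
    by_contra h
    nlinarith [mul_nonneg hA (not_lt.mp h |> neg_nonneg.mpr)]
  have hA' : (0 : ℝ) < Fintype.card A := by
    rcases hA.eq_or_lt with h | h
    · rw [← h] at hcard; linarith
    · exact h
  rw [if_pos hx, EReal.coe_le_coe_iff, neg_le_iff_add_nonneg, ← Real.logb_mul hA'.ne' hx.ne']
  exact Real.logb_nonneg (by norm_num) hcard

lemma logb_le_oneWayDistillable {ρ : Matrix (A × B) (A × B) ℂ} (hρ : IsState ρ) {ε : ℝ}
    (hε : 0 ≤ ε) {i : ℝ} (hi : smoothZeroCoherentInfo ρ (ε / 8) = i) {m : ℕ} (hm : 1 ≤ m)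
    (hmi : m ≤ (2 : ℝ) ^ i * (1 / (Fintype.card A : ℝ) + ε ^ 2 / 4)) :
    ((Real.logb 2 m : ℝ) : EReal) ≤ oneWayDistillable ρ ε := by
  rcases le_or_gt 1 ε with hε1 | hε1
  · rw [oneWayDistillable_of_one_le ρ hε1]; exact le_top
  rcases hm.eq_or_lt with rfl | hm2
  · simpa using (isAchievableRate_zero hρ hε).le_oneWayDistillable
  -- A maximizing `ρ'` need not be exhibited: one that is optimal up to a factor `5/4` suffices,
  -- thanks to the slack in `isAchievableRate_logb`.
  have hlt : ((i - Real.logb 2 (5 / 4) : ℝ) : EReal) < smoothZeroCoherentInfo ρ (ε / 8) := by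
    rw [hi, EReal.coe_lt_coe_iff]
    have : 0 < Real.logb 2 (5 / 4) := Real.logb_pos (by norm_num) (by norm_num)
    linarith
  obtain ⟨ρ', hlt⟩ := lt_iSup_iff.mp hlt
  obtain ⟨hρ', hlt⟩ := lt_iSup_iff.mp hlt
  refine (isAchievableRate_logb hρ hε hε1 hρ' (lam := 5 / 4 * (2 : ℝ) ^ (-i)) (fun σ hσ => ?_)
    hm2 ?_).le_oneWayDistillable
  · have h := hlt.trans_le (iInf₂_le σ hσ)
    unfold relRenyiZero at h
    generalize (suppProj ρ' * ((1 : Matrix A A ℂ) ⊗ₖ σ)).trace.re = x at *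
    rcases lt_or_ge 0 x with hx | hx
    · rw [if_pos hx, EReal.coe_lt_coe_iff] at h
      have h2 : Real.logb 2 x ≤ Real.logb 2 (5 / 4) + -i := by linarith
      rw [Real.logb_le_iff_le_rpow (by norm_num) hx, Real.rpow_add (by norm_num),
        Real.rpow_logb (by norm_num) (by norm_num) (by norm_num)] at h2
      exact h2
    · exact hx.trans (by positivity)
  · have hpos : (0 : ℝ) < 2 ^ i := by positivity
    rw [Real.rpow_neg (by norm_num)]
    calc (m : ℝ) * (5 / 4 * (2 ^ i)⁻¹)
        ≤ (2 ^ i * (1 / (Fintype.card A : ℝ) + ε ^ 2 / 4)) * (5 / 4 * (2 ^ i)⁻¹) :=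
          mul_le_mul_of_nonneg_right hmi (by positivity)
      _ = 5 / 4 * (1 / (Fintype.card A : ℝ) + ε ^ 2 / 4) := by
          field_simp

end Achievability

/-- Rounding a nonnegative real down to the logarithm of a positive integer. -/
lemma exists_isLeast_logb_gap {r : ℝ} (hr : 0 ≤ r) :
    ∃ m : ℕ, 1 ≤ m ∧ (m : ℝ) ≤ 2 ^ r ∧ r - Real.logb 2 m ≤ 1 ∧
      IsLeast {t : ℝ | 0 ≤ t ∧ ∃ k : ℕ, 1 ≤ k ∧ r - t = Real.logb 2 k} (r - Real.logb 2 m) := by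
  have h1 : (1 : ℝ) ≤ 2 ^ r := Real.one_le_rpow (by norm_num) hr
  have hm1 : 1 ≤ ⌊(2 : ℝ) ^ r⌋₊ := (Nat.one_le_floor_iff _).mpr h1
  have hle : ((⌊(2 : ℝ) ^ r⌋₊ : ℕ) : ℝ) ≤ 2 ^ r := Nat.floor_le (by positivity)
  have hlt := Nat.lt_floor_add_one ((2 : ℝ) ^ r)
  refine ⟨⌊(2 : ℝ) ^ r⌋₊, hm1, hle, ?_, ⟨?_, _, hm1, by ring⟩, ?_⟩
  · have hmR : (1 : ℝ) ≤ (⌊(2 : ℝ) ^ r⌋₊ : ℕ) := by exact_mod_cast hm1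
    -- From `2 ^ r < m + 1 ≤ 2m` for the floor `m ≥ 1`; hence rounding costs at most one bit.
    have h2 : (2 : ℝ) ^ r ≤ 2 * (⌊(2 : ℝ) ^ r⌋₊ : ℕ) := by linarith
    rw [← Real.le_logb_iff_rpow_le (by norm_num) (by linarith),
      Real.logb_mul (by norm_num) (by linarith), Real.logb_self_eq_one (by norm_num)] at h2
    linarith
  · rw [sub_nonneg, Real.logb_le_iff_le_rpow (by norm_num) (by exact_mod_cast hm1)]
    exact hle
  · rintro t ⟨ht, k, hk, hkt⟩
    have hk0 : (0 : ℝ) < k := by exact_mod_cast hk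
    have h2 : Real.logb 2 k ≤ r := by linarith
    rw [Real.logb_le_iff_le_rpow (by norm_num) hk0] at h2
    have h3 : Real.logb 2 k ≤ Real.logb 2 (⌊(2 : ℝ) ^ r⌋₊ : ℕ) :=
      Real.logb_le_logb_of_le (by norm_num) hk0 (by exact_mod_cast Nat.le_floor h2)
    linarith

end OneShot

/-! ### The hashing bound, by cases on the value of the coherent information -/

theorem mainTheorem2 {A B : Type*} [Fintype A] [DecidableEq A] [Fintype B] [DecidableEq B]
    (ρ : Matrix (A × B) (A × B) ℂ) (hρ : OneShot.IsState ρ) (ε : ℝ) (hε : 0 ≤ ε) :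
    ∃ Δ : ℝ, 0 ≤ Δ ∧ Δ ≤ 1 ∧
      OneShot.smoothZeroCoherentInfo ρ (ε / 8)
          + ((Real.logb 2 (1 / (Fintype.card A : ℝ) + ε ^ 2 / 4) : ℝ) : EReal) - (Δ : EReal)
        ≤ OneShot.oneWayDistillable ρ ε ∧
      ∀ r : ℝ,
        (r : EReal) = OneShot.smoothZeroCoherentInfo ρ (ε / 8)
          + ((Real.logb 2 (1 / (Fintype.card A : ℝ) + ε ^ 2 / 4) : ℝ) : EReal) →
        (0 ≤ r → IsLeast {t : ℝ | 0 ≤ t ∧ ∃ m : ℕ, 1 ≤ m ∧ r - t = Real.logb 2 m} Δ) ∧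
        (r < 0 → Δ = 0) := by
  have hA : (0 : ℝ) < Fintype.card A := by
    rcases (Nat.cast_nonneg (α := ℝ) (Fintype.card A)).eq_or_lt with h | h
    · have hempty : IsEmpty A := Fintype.card_eq_zero_iff.mp (by exact_mod_cast h.symm)
      have := hρ.2
      simp [Matrix.trace] at this
    · exact h
  have hw : 0 < 1 / (Fintype.card A : ℝ) + ε ^ 2 / 4 := by positivity
  set w := 1 / (Fintype.card A : ℝ) + ε ^ 2 / 4
  generalize hI : OneShot.smoothZeroCoherentInfo ρ (ε / 8) = I
  induction I with
  | bot =>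
    refine ⟨0, le_rfl, zero_le_one, ?_, fun r hr => ?_⟩
    · rw [EReal.bot_add, EReal.bot_sub]; exact bot_le
    · rw [EReal.bot_add] at hr; exact absurd hr (EReal.coe_ne_bot r)
  | top =>
    -- An infinite value requires smoothing radius at least `1`, hence `ε ≥ 8`; only `ε ≥ 1` is
    -- needed.
    have hε1 : 1 ≤ ε := by
      by_contra h
      exact OneShot.smoothZeroCoherentInfo_ne_top ρ (by nlinarith) hI
    refine ⟨0, le_rfl, zero_le_one, ?_, fun r hr => ?_⟩
    · rw [OneShot.oneWayDistillable_of_one_le ρ hε1]; exact le_top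
    · rw [EReal.top_add_coe] at hr; exact absurd hr (EReal.coe_ne_top r)
  | coe i =>
    rw [← EReal.coe_add]
    set r₀ := i + Real.logb 2 w with hr₀
    rcases le_or_gt 0 r₀ with h0 | h0
    · obtain ⟨m, hm, hmr, hgap, hleast⟩ := OneShot.exists_isLeast_logb_gap h0
      refine ⟨r₀ - Real.logb 2 m, hleast.1.1, hgap, ?_, fun r hr => ?_⟩
      · rw [← EReal.coe_sub, sub_sub_cancel]
        refine OneShot.logb_le_oneWayDistillable hρ hε hI hm (hmr.trans_eq ?_)
        rw [hr₀, Real.rpow_add (by norm_num), Real.rpow_logb (by norm_num) (by norm_num) hw]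
      · obtain rfl : r = r₀ := by exact_mod_cast hr
        exact ⟨fun _ => hleast, fun h => absurd h0 (not_le.mpr h)⟩
    · refine ⟨0, le_rfl, zero_le_one, ?_, fun r hr => ?_⟩
      · rw [← EReal.coe_sub, sub_zero]
        refine le_trans ?_ (OneShot.isAchievableRate_zero hρ hε).le_oneWayDistillable
        exact_mod_cast h0.le
      · obtain rfl : r = r₀ := by exact_mod_cast hr
        exact ⟨fun h => absurd h0 (not_lt.mpr h), fun _ => rfl⟩
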